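/- Fix an integer $K\ge 2$, a probability vector $\alpha=(\alpha_1,\dots,\alpha_K)$ with all $\alpha_k>0$, and a finite set $\mathcal M$ of integers $m\ge 2$. For $m\ge 0$, let $\mathrm{WC}_m^K$ be the set of $w\in\mathbb Z_{\ge 0}^K$ with $\sum_k w_k=m$, and let $j\oplus w$ be $w$ with its $j$-th entry increased by one. For each $n$, let real parameters $\mathcal P^{(m)}_w=\mathcal P^{(m)}_w(n)$ ($m\in\mathcal M$, $w\in\mathrm{WC}_m^K$) be given, possibly depending on $n$. In the non-uniform hypergraph stochastic block model on the vertex set $[n]$, the entries of the membership vector $z\in[K]^n$ are drawn independently with $\mathbb P(z_v=k)=\alpha_k$; then, given $z$, every $e\subseteq[n]$ with $|e|=m\in\mathcal M$ is, independently of the others, a hyperedge of $H$ with probability $$\mathcal Q^{(m)}_w=\mathcal P^{(m)}_w\,\frac{\log n}{\binom{n-1}{m-1}},$$ where $w_k$ is the number of vertices of $e$ in community $k$. Assume the exact recovery regime: there is a constant $c>0$ such that $\mathcal P^{(m)}_w\ge c$ for all $m\in\mathcal M$, $w\in\mathrm{WC}_m^K$ and all sufficiently large $n$, and $\mathcal Q^{(m)}_w\to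 0$ as $n\to\infty$ for all such $m,w$. (In particular $\mathcal Q^{(m)}_w\in[0,1]$ for all large $n$, so the model is defined for these $n$.) For communities $j\ne k$ put $$D_{\rm GCH}(j,k)=\max_{t\in[0,1]}\sum_{m\in\mathcal M}\ \sum_{w\in \mathrm{WC}_{m-1}^K}\frac{\bar n_w}{\binom{n-1}{m-1}}\Big[t\,\mathcal P^{(m)}_{j\oplus w}+(1-t)\,\mathcal P^{(m)}_{k\oplus w}-\big(\mathcal P^{(m)}_{j\oplus w}\big)^{t}\big(\mathcal P^{(m)}_{k\oplus w}\big)^{1-t}\Big],\qquad \bar n_w=\prod_{l=1}^K\binom{\lfloor\alpha_l n\rfloor}{w_l},$$ and $D_{\rm GCH}=\min_{j\ne k}D_{\rm GCH}(j,k)$; both depend on $n$. For an estimate $\hat z\in[K]^n$ of $z$ let $\eta_n=\frac1n\min_{\pi\in S_K}\#\{v\in[n]:\pi(z_v)\ne\hat z_v\}$ be the mismatch ratio; an algorithm achieves exact recovery if $\mathbb P(\eta_n=0)\to1$. **Theorem (Impossibility).** Suppose that $D_{\rm GCH}<1$, in the sense that there is a constant $\varepsilon>0$, independent of $n$, with $D_{\rm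 GCH}\le 1-\varepsilon$ for all sufficiently large $n$. Then exact recovery is impossible: no algorithm, i.e. no sequence of (possibly randomized) maps $H\mapsto\hat z$, even with full knowledge of $K,\alpha,\mathcal M$ and the $\mathcal P^{(m)}_w$, achieves exact recovery. Moreover, every algorithm misclassifies at least one vertex with high probability, i.e. $\mathbb P(\eta_n>0)\to 1$ as $n\to\infty$. -/

import Mathlib

open Filter Topology

namespace HSBM

noncomputable section

/-- The set `WC m K` of weak compositions of `m` into `K` nonnegative parts. -/
def weakComps (K m : ℕ) : Finset (Fin K → ℕ) :=
  Finset.piAntidiag Finset.univ m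

/-- `j ⊕ w`: the weak composition `w` with its `j`-th part increased by one. -/
def bump {K : ℕ} (j : Fin K) (w : Fin K → ℕ) : Fin K → ℕ :=
  Function.update w j (w j + 1)

/-- Membership counts of a set `e` of vertices under the labelling `z`: the `k`-th entry is the
number of vertices of `e` in community `k`. -/
def counts {K n : ℕ} (z : Fin n → Fin K) (e : Finset (Fin n)) : Fin K → ℕ :=
  fun k => (e.filter fun v => z v = k).card

/-- The hyperedge probability `Q^{(m)}_w = P^{(m)}_w * log n / C(n-1, m-1)` on `n` vertices, where
the parameters `P^{(m)}_w` are allowed to depend on `n`. -/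
def edgeProb {K : ℕ} (P : ℕ → ℕ → (Fin K → ℕ) → ℝ) (n m : ℕ) (w : Fin K → ℕ) : ℝ :=
  P n m w * (Real.log n / ((n - 1).choose (m - 1) : ℝ))

/-- A non-uniform hypergraph on `[n]`, as its set of hyperedges. -/
abbrev Hypergraph (n : ℕ) := Finset (Finset (Fin n))

/-- All possible hyperedges: the subsets of `[n]` whose size belongs to `M`. -/
def possibleEdges (M : Finset ℕ) (n : ℕ) : Finset (Finset (Fin n)) :=
  Finset.univ.filter fun e => e.card ∈ M

/-- Probability of the membership vector `z`, its entries being independent with law `α`. -/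
def labelMass {K : ℕ} (α : Fin K → ℝ) {n : ℕ} (z : Fin n → Fin K) : ℝ :=
  ∏ v, α (z v)

open Classical in
/-- Conditional probability of the hypergraph `H` given the membership vector `z`: the possible
hyperedges `e` are present independently, with probability `q |e| (counts z e)`. -/
def edgeMass {K : ℕ} (M : Finset ℕ) (q : ℕ → (Fin K → ℕ) → ℝ) {n : ℕ}
    (z : Fin n → Fin K) (H : Hypergraph n) : ℝ :=
  ∏ e ∈ possibleEdges M n,
    if e ∈ H then q e.card (counts z e) else 1 - q e.card (counts z e)

/-- Expectation of `f (z, H)` for `(z, H)` drawn from the non-uniform HSBM on `n` vertices with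
membership law `α`, hyperedge sizes `M` and hyperedge probabilities `q`. -/
def expectation {K : ℕ} (α : Fin K → ℝ) (M : Finset ℕ) (q : ℕ → (Fin K → ℕ) → ℝ) (n : ℕ)
    (f : (Fin n → Fin K) → Hypergraph n → ℝ) : ℝ :=
  ∑ z : Fin n → Fin K, ∑ H ∈ (possibleEdges M n).powerset,
    labelMass α z * edgeMass M q z H * f z H

/-- The masses of the non-uniform HSBM add up to one. -/
theorem expectation_one {K : ℕ} (α : Fin K → ℝ) (hα : ∑ k, α k = 1) (M : Finset ℕ)
    (q : ℕ → (Fin K → ℕ) → ℝ) (n : ℕ) : expectation α M q n (fun _ _ => 1) = 1 := by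
  classical
  have h1 : ∀ z : Fin n → Fin K,
      ∑ H ∈ (possibleEdges M n).powerset, edgeMass M q z H = 1 := by
    intro z
    have h := Finset.prod_add (fun e : Finset (Fin n) => q e.card (counts z e))
      (fun e => 1 - q e.card (counts z e)) (possibleEdges M n)
    simp only [add_sub_cancel, Finset.prod_const_one] at h
    rw [h]
    refine Finset.sum_congr rfl fun H hH => ?_
    have hsub := Finset.mem_powerset.mp hH
    unfold edgeMass
    rw [Finset.prod_ite, Finset.filter_mem_eq_inter, Finset.inter_eq_right.mpr hsub]
    congr 2
    ext e
    simp [Finset.mem_sdiff]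
  have h2 : ∑ z : Fin n → Fin K, labelMass α z = 1 := by
    have h := Finset.prod_univ_sum (fun _ : Fin n => (Finset.univ : Finset (Fin K)))
      (fun _ k => α k)
    rw [Fintype.piFinset_univ] at h
    unfold labelMass
    rw [← h]
    simp [hα]
  unfold expectation
  simp only [mul_one, ← Finset.mul_sum, h1, h2]

/-- The mismatch ratio `η(z, z')`: the proportion of vertices on which `z'` differs from `z`,
minimized over the relabellings of the communities. -/
def mismatch {K n : ℕ} (z z' : Fin n → Fin K) : ℝ :=
  (1 / (n : ℝ)) * ⨅ π : Equiv.Perm (Fin K), (hammingDist (π ∘ z) z' : ℝ)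

/-- An algorithm with `K` communities: for each `n`, a possibly randomized map from hypergraphs on
`n` vertices to membership vectors. It may use the parameters of the model. -/
abbrev Algorithm (K : ℕ) := ∀ n : ℕ, Hypergraph n → PMF (Fin n → Fin K)

open Classical in
/-- The probability that the mismatch ratio of the algorithm `A` satisfies `p`, under the model
and the internal randomness of `A`. -/
def mismatchProb {K : ℕ} (α : Fin K → ℝ) (M : Finset ℕ) (q : ℕ → (Fin K → ℕ) → ℝ)
    (A : Algorithm K) (n : ℕ) (p : ℝ → Prop) : ℝ :=
  expectation α M q n fun z H =>
    ∑ z' : Fin n → Fin K, if p (mismatch z z') then (A n H z').toReal else 0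

/-- The algorithm `A` achieves exact recovery: `P(η_n = 0) → 1`. -/
def ExactRecovery {K : ℕ} (α : Fin K → ℝ) (M : Finset ℕ)
    (P : ℕ → ℕ → (Fin K → ℕ) → ℝ) (A : Algorithm K) : Prop :=
  Tendsto (fun n => mismatchProb α M (edgeProb P n) A n fun η => η = 0) atTop (𝓝 1)

/-- `n̄_w = ∏ₗ C(⌊αₗ n⌋, wₗ)`. -/
def nbar {K : ℕ} (α : Fin K → ℝ) (n : ℕ) (w : Fin K → ℕ) : ℝ :=
  ∏ l, ((⌊α l * n⌋₊.choose (w l) : ℕ) : ℝ)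

/-- The generalized Chernoff–Hellinger divergence between the communities `j` and `k`. -/
def gchPair {K : ℕ} (α : Fin K → ℝ) (M : Finset ℕ) (P : ℕ → ℕ → (Fin K → ℕ) → ℝ)
    (n : ℕ) (j k : Fin K) : ℝ :=
  ⨆ t : Set.Icc (0 : ℝ) 1, ∑ m ∈ M, ∑ w ∈ weakComps K (m - 1),
    nbar α n w / ((n - 1).choose (m - 1) : ℝ) *
      ((t : ℝ) * P n m (bump j w) + (1 - (t : ℝ)) * P n m (bump k w)
        - P n m (bump j w) ^ (t : ℝ) * P n m (bump k w) ^ (1 - (t : ℝ)))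

/-- The generalized Chernoff–Hellinger divergence of the model on `n` vertices: the minimum over
pairs of distinct communities. -/
def gch {K : ℕ} (α : Fin K → ℝ) (M : Finset ℕ) (P : ℕ → ℕ → (Fin K → ℕ) → ℝ) (n : ℕ) : ℝ :=
  ⨅ p : {p : Fin K × Fin K // p.1 ≠ p.2}, gchPair α M P n p.1.1 p.1.2

end

end HSBM

/-!
The posterior distribution of the labels is spread over many labellings. If moving any one of `N`
vertices from a community `j` to a community `k` multiplies the likelihood by at least `ρ`, then
these `N` labellings compete with the true one, whose posterior probability is therefore of order
`1 / (N ρ)` at most, and no estimator, randomized or not, hits it (or one of its `K!` relabellings)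
with larger probability: `mismatchProb_eq_zero_le`. It remains to find such vertices.

Let `j ≠ k` attain the minimal divergence, which is at most `1 - ε`. For a single vertex `v` of
community `j`, the probability that its hyperedges look almost as likely after the move is bounded
below by a change of measure (`le_prob_likelihoodRatio_ge`): along the geometric path between the
two product laws there is, by Rolle's theorem, a law under which the log-likelihood ratio has mean
zero; its variance is `O(log n)`, so it is `o(log n)` with high probability, and the price of the
change of measure is a product of affinities, which is at least `n ^ (-(1 - ε / 2))`. The parameters
may be unbounded, but a bounded divergence keeps `√P_j - √P_k` bounded (`sq_sqrt_sub_sqrt_le`), and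
with the lower bound on the parameters this controls the ratios of the edge probabilities and all
error terms through the squared Hellinger distance.

To obtain many such vertices at once, `κ n` vertices of community `j` are considered. The hyperedges
containing exactly one of them give independent events, whose number concentrates around its mean,
at least of order `n ^ (ε / 2 - δ)`. The hyperedges containing two or more of them carry little
information if `κ` is small: Markov's inequality for the inverse likelihood ratio shows that they
rarely reduce the likelihood by more than the factor `n ^ (-δ)` (`prob_likelihoodRatio_lt_le`), and
as they are independent of the former events, only a small fraction of the vertices is lost
(`prob_card_lt_le`, `prob_confusable_card_lt_le`).
-/

namespace HSBM

/-! ### Independent Bernoulli edges -/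

/-- The probability that a random subset of `E`, containing each `e ∈ E` independently with
probability `p e`, equals `H`. -/
noncomputable def bernoulliMass {ι : Type*} [DecidableEq ι] (E : Finset ι) (p : ι → ℝ)
    (H : Finset ι) : ℝ :=
  ∏ e ∈ E, if e ∈ H then p e else 1 - p e

/-- The expectation of `f H` for a random `H ⊆ E` that contains each `e ∈ E` independently with
probability `p e`. -/
noncomputable def bernoulliExp {ι : Type*} [DecidableEq ι] (E : Finset ι) (p : ι → ℝ)
    (f : Finset ι → ℝ) : ℝ :=
  ∑ H ∈ E.powerset, bernoulliMass E p H * f H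

section Bernoulli

variable {ι : Type*} [DecidableEq ι] {E : Finset ι} {p : ι → ℝ} {f g : Finset ι → ℝ}

theorem bernoulliMass_nonneg (hp : ∀ e ∈ E, 0 ≤ p e ∧ p e ≤ 1) (H : Finset ι) :
    0 ≤ bernoulliMass E p H := by
  refine Finset.prod_nonneg fun e he => ?_
  split_ifs
  · exact (hp e he).1
  · linarith [(hp e he).2]

theorem bernoulliExp_congr (h : ∀ H ⊆ E, f H = g H) :
    bernoulliExp E p f = bernoulliExp E p g :=
  Finset.sum_congr rfl fun H hH => by rw [h H (Finset.mem_powerset.mp hH)]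

theorem bernoulliExp_mono (hp : ∀ e ∈ E, 0 ≤ p e ∧ p e ≤ 1) (h : ∀ H ⊆ E, f H ≤ g H) :
    bernoulliExp E p f ≤ bernoulliExp E p g :=
  Finset.sum_le_sum fun H hH =>
    mul_le_mul_of_nonneg_left (h H (Finset.mem_powerset.mp hH)) (bernoulliMass_nonneg hp H)

theorem bernoulliExp_add (f g : Finset ι → ℝ) :
    bernoulliExp E p (fun H => f H + g H) = bernoulliExp E p f + bernoulliExp E p g := by
  simp [bernoulliExp, mul_add, Finset.sum_add_distrib]

theorem bernoulliExp_const_mul (c : ℝ) (f : Finset ι → ℝ) :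
    bernoulliExp E p (fun H => c * f H) = c * bernoulliExp E p f := by
  simp only [bernoulliExp, Finset.mul_sum]
  exact Finset.sum_congr rfl fun H _ => by ring

theorem bernoulliExp_mul_const (c : ℝ) (f : Finset ι → ℝ) :
    bernoulliExp E p (fun H => f H * c) = bernoulliExp E p f * c := by
  simp only [bernoulliExp, Finset.sum_mul]
  exact Finset.sum_congr rfl fun H _ => by ring

theorem bernoulliExp_sum {V : Type*} (S : Finset V) (f : V → Finset ι → ℝ) :
    bernoulliExp E p (fun H => ∑ v ∈ S, f v H) = ∑ v ∈ S, bernoulliExp E p (f v) := by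
  simp only [bernoulliExp, Finset.mul_sum]
  exact Finset.sum_comm

/-- The expectation of a product of functions of the single edges factorizes. -/
theorem bernoulliExp_prod (A B : ι → ℝ) :
    bernoulliExp E p (fun H => ∏ e ∈ E, if e ∈ H then A e else B e)
      = ∏ e ∈ E, (p e * A e + (1 - p e) * B e) := by
  rw [Finset.prod_add]
  refine Finset.sum_congr rfl fun H hH => ?_
  have hsub := Finset.mem_powerset.mp hH
  rw [bernoulliMass, ← Finset.prod_mul_distrib]
  have : ∀ e ∈ E, ((if e ∈ H then p e else 1 - p e) * if e ∈ H then A e else B e)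
      = if e ∈ H then p e * A e else (1 - p e) * B e := by
    intro e _; split_ifs <;> rfl
  rw [Finset.prod_congr rfl this, Finset.prod_ite, Finset.filter_mem_eq_inter,
    Finset.inter_eq_right.mpr hsub]
  congr 2
  ext e
  simp [Finset.mem_sdiff]

theorem bernoulliExp_one : bernoulliExp E p (fun _ => 1) = 1 := by
  simpa using bernoulliExp_prod (E := E) (p := p) (fun _ => 1) (fun _ => 1)

theorem bernoulliExp_const (c : ℝ) : bernoulliExp E p (fun _ => c) = c := by
  simpa [bernoulliExp_one] using bernoulliExp_mul_const (E := E) (p := p) c (fun _ => 1)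

theorem bernoulliExp_insert {a : ι} (ha : a ∉ E) (f : Finset ι → ℝ) :
    bernoulliExp (insert a E) p f
      = p a * bernoulliExp E p (fun H => f (insert a H)) + (1 - p a) * bernoulliExp E p f := by
  unfold bernoulliExp
  rw [Finset.sum_powerset_insert ha, add_comm, Finset.mul_sum, Finset.mul_sum]
  congr 1 <;> refine Finset.sum_congr rfl fun H hH => ?_
  · have : bernoulliMass E p (insert a H) = bernoulliMass E p H := by
      refine Finset.prod_congr rfl fun e he => ?_
      have : e ≠ a := fun h => ha (h ▸ he)
      simp [this]
    rw [bernoulliMass, Finset.prod_insert ha, ← bernoulliMass, this]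
    simp; ring
  · have : a ∉ H := fun h => ha (Finset.mem_powerset.mp hH h)
    rw [bernoulliMass, Finset.prod_insert ha, ← bernoulliMass]
    simp [this]; ring

/-- Fubini: the edges in two disjoint sets may be drawn one set after the other. -/
theorem bernoulliExp_union {E₁ E₂ : Finset ι} (h : Disjoint E₁ E₂) (f : Finset ι → ℝ) :
    bernoulliExp (E₁ ∪ E₂) p f
      = bernoulliExp E₁ p fun H₁ => bernoulliExp E₂ p fun H₂ => f (H₁ ∪ H₂) := by
  induction E₁ using Finset.induction_on generalizing f with
  | empty => simp [bernoulliExp, bernoulliMass]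
  | insert a E ha ih =>
    rw [Finset.disjoint_insert_left] at h
    rw [Finset.insert_union, bernoulliExp_insert (by simp [ha, h.1]), bernoulliExp_insert ha,
      ih h.2, ih h.2]
    simp [Finset.insert_union]

/-- A function of the edges in `E₁` has the same mean under the marginal law on `E₁`. -/
theorem bernoulliExp_marginal {E₁ : Finset ι} (h : E₁ ⊆ E) (hf : ∀ H, f H = f (H ∩ E₁)) :
    bernoulliExp E p f = bernoulliExp E₁ p f := by
  conv_lhs => rw [← Finset.union_sdiff_of_subset h]
  rw [bernoulliExp_union Finset.disjoint_sdiff]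
  refine bernoulliExp_congr fun H₁ hH₁ => ?_
  rw [← bernoulliExp_const (E := E \ E₁) (p := p) (f H₁)]
  refine bernoulliExp_congr fun H₂ hH₂ => ?_
  rw [hf (H₁ ∪ H₂), hf H₁]
  congr 1
  ext e
  have := @hH₂ e
  simp only [Finset.mem_sdiff, Finset.mem_inter, Finset.mem_union] at this ⊢
  tauto

/-- Functions of disjoint sets of edges are independent. -/
theorem bernoulliExp_mul {E₁ E₂ : Finset ι} (h₁ : E₁ ⊆ E) (h₂ : E₂ ⊆ E) (hd : Disjoint E₁ E₂)
    (hf : ∀ H, f H = f (H ∩ E₁)) (hg : ∀ H, g H = g (H ∩ E₂)) :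
    bernoulliExp E p (fun H => f H * g H) = bernoulliExp E p f * bernoulliExp E p g := by
  have h2' : E₂ ⊆ E \ E₁ := fun e he =>
    Finset.mem_sdiff.mpr ⟨h₂ he, Finset.disjoint_right.mp hd he⟩
  rw [bernoulliExp_marginal h₁ hf, bernoulliExp_marginal h₂ hg, ← bernoulliExp_marginal h2' hg]
  conv_lhs => rw [← Finset.union_sdiff_of_subset h₁]
  rw [bernoulliExp_union Finset.disjoint_sdiff, ← bernoulliExp_mul_const]
  refine bernoulliExp_congr fun H₁ hH₁ => ?_
  rw [← bernoulliExp_const_mul]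
  refine bernoulliExp_congr fun H₂ hH₂ => ?_
  rw [hf (H₁ ∪ H₂), hf H₁, hg (H₁ ∪ H₂), hg H₂]
  have hd' := Finset.disjoint_left.mp hd
  congr 2 <;> ext e <;> have := @hH₂ e <;> have := @hH₁ e <;> have := @hd' e <;>
    simp only [Finset.mem_sdiff, Finset.mem_inter, Finset.mem_union] at * <;> tauto

theorem bernoulliExp_sum_edges (a b : ι → ℝ) :
    bernoulliExp E p (fun H => ∑ e ∈ E, if e ∈ H then a e else b e)
      = ∑ e ∈ E, (p e * a e + (1 - p e) * b e) := by
  rw [bernoulliExp_sum]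
  refine Finset.sum_congr rfl fun e he => ?_
  have hs : ({e} : Finset ι) ⊆ E := Finset.singleton_subset_iff.mpr he
  rw [bernoulliExp_marginal hs (fun H => by simp)]
  simpa using bernoulliExp_prod (E := {e}) (p := p) a b

/-- The second moment of a sum of independent terms, one for each edge. -/
theorem bernoulliExp_sum_edges_sq (a b : ι → ℝ) :
    bernoulliExp E p (fun H => (∑ e ∈ E, if e ∈ H then a e else b e) ^ 2)
      = (∑ e ∈ E, (p e * a e + (1 - p e) * b e)) ^ 2
        + ∑ e ∈ E, p e * (1 - p e) * (a e - b e) ^ 2 := by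
  induction E using Finset.induction_on with
  | empty => simp [bernoulliExp, bernoulliMass]
  | insert c E hc ih =>
    have key : ∀ x : ℝ, bernoulliExp E p (fun H => (x + ∑ e ∈ E, if e ∈ H then a e else b e) ^ 2)
        = x ^ 2 + 2 * x * (∑ e ∈ E, (p e * a e + (1 - p e) * b e))
          + bernoulliExp E p (fun H => (∑ e ∈ E, if e ∈ H then a e else b e) ^ 2) := by
      intro x
      rw [← bernoulliExp_sum_edges, ← bernoulliExp_const_mul]
      conv_rhs => rw [← bernoulliExp_const (E := E) (p := p) (x ^ 2)]
      rw [← bernoulliExp_add, ← bernoulliExp_add]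
      exact bernoulliExp_congr fun H _ => by ring
    have h1 : bernoulliExp E p
        (fun H => (∑ e ∈ insert c E, if e ∈ insert c H then a e else b e) ^ 2)
        = bernoulliExp E p (fun H => (a c + ∑ e ∈ E, if e ∈ H then a e else b e) ^ 2) := by
      refine bernoulliExp_congr fun H _ => ?_
      rw [Finset.sum_insert hc]
      congr 2
      · simp
      · refine Finset.sum_congr rfl fun e he => ?_
        have : e ≠ c := fun h => hc (h ▸ he)
        simp [this]
    have h2 : bernoulliExp E p (fun H => (∑ e ∈ insert c E, if e ∈ H then a e else b e) ^ 2)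
        = bernoulliExp E p (fun H => (b c + ∑ e ∈ E, if e ∈ H then a e else b e) ^ 2) := by
      refine bernoulliExp_congr fun H hH => ?_
      rw [Finset.sum_insert hc, if_neg fun h => hc (hH h)]
    rw [bernoulliExp_insert hc, h1, h2, key, key, ih, Finset.sum_insert hc, Finset.sum_insert hc]
    ring

/-- Tilting: reweighting the law with parameter `p` by a product of functions of the single edges
gives, up to the normalizing constant, a law of the same kind. -/
theorem bernoulliExp_tilt (A B : ι → ℝ) (h0 : ∀ e ∈ E, p e * A e + (1 - p e) * B e ≠ 0)
    (f : Finset ι → ℝ) :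
    bernoulliExp E p (fun H => (∏ e ∈ E, if e ∈ H then A e else B e) * f H)
      = (∏ e ∈ E, (p e * A e + (1 - p e) * B e))
        * bernoulliExp E (fun e => p e * A e / (p e * A e + (1 - p e) * B e)) f := by
  simp only [bernoulliExp, Finset.mul_sum]
  refine Finset.sum_congr rfl fun H _ => ?_
  rw [← mul_assoc, ← mul_assoc, bernoulliMass, bernoulliMass, ← Finset.prod_mul_distrib,
    ← Finset.prod_mul_distrib]
  congr 1
  refine Finset.prod_congr rfl fun e he => ?_
  have := h0 e he
  split_ifs
  · field_simp
  · field_simp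
    ring

end Bernoulli


/-! ### Testing one product of Bernoulli laws against another -/

/-- The likelihood ratio of the edge probabilities `r` against `p`, over the edges in `E`. -/
noncomputable def likelihoodRatio {ι : Type*} [DecidableEq ι] (E : Finset ι) (p r : ι → ℝ)
    (H : Finset ι) : ℝ :=
  ∏ e ∈ E, if e ∈ H then r e / p e else (1 - r e) / (1 - p e)

/-- The Hellinger-type affinity `∑ P^(1-s) R^s` of the Bernoulli laws with means `p` and `r`. -/
noncomputable def affinity (s p r : ℝ) : ℝ :=
  p ^ (1 - s) * r ^ s + (1 - p) ^ (1 - s) * (1 - r) ^ s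

/-- The mean of the Bernoulli law on the geometric path, at time `s`, from the Bernoulli law with
mean `p` to the one with mean `r`. -/
noncomputable def tiltedMean (s p r : ℝ) : ℝ :=
  p ^ (1 - s) * r ^ s / affinity s p r

theorem affinity_pos {s p r : ℝ} (hp : 0 < p ∧ p < 1) (hr : 0 < r ∧ r < 1) :
    0 < affinity s p r := by
  have := sub_pos.mpr hp.2
  have := sub_pos.mpr hr.2
  have := hp.1
  have := hr.1
  unfold affinity
  positivity

theorem one_sub_tiltedMean {s p r : ℝ} (hp : 0 < p ∧ p < 1) (hr : 0 < r ∧ r < 1) :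
    1 - tiltedMean s p r = (1 - p) ^ (1 - s) * (1 - r) ^ s / affinity s p r := by
  rw [tiltedMean, eq_div_iff (affinity_pos hp hr).ne', sub_mul,
    div_mul_cancel₀ _ (affinity_pos hp hr).ne', affinity]
  ring

theorem tiltedMean_mem {s p r : ℝ} (hp : 0 < p ∧ p < 1) (hr : 0 < r ∧ r < 1) :
    0 ≤ tiltedMean s p r ∧ tiltedMean s p r ≤ 1 := by
  have h1 := sub_pos.mpr hp.2
  have h2 := sub_pos.mpr hr.2
  have h3 := hp.1
  have h4 := hr.1
  have h5 := affinity_pos (s := s) hp hr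
  have h6 := one_sub_tiltedMean (s := s) hp hr
  refine ⟨by unfold tiltedMean; positivity, ?_⟩
  have : 0 ≤ 1 - tiltedMean s p r := by rw [h6]; positivity
  linarith

theorem mul_exp_mul_log_div {s p r : ℝ} (hp : 0 < p) (hr : 0 < r) :
    p * Real.exp (s * Real.log (r / p)) = p ^ (1 - s) * r ^ s := by
  rw [Real.rpow_def_of_pos hp, Real.rpow_def_of_pos hr, Real.log_div hr.ne' hp.ne', ← Real.exp_add]
  nth_rewrite 1 [← Real.exp_log hp]
  rw [← Real.exp_add]
  ring_nf

section Test

variable {ι : Type*} [DecidableEq ι] {E : Finset ι} {p r : ι → ℝ}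

theorem likelihoodRatio_eq_exp (hp : ∀ e ∈ E, 0 < p e ∧ p e < 1)
    (hr : ∀ e ∈ E, 0 < r e ∧ r e < 1) (H : Finset ι) :
    likelihoodRatio E p r H = Real.exp (∑ e ∈ E,
      if e ∈ H then Real.log (r e / p e) else Real.log ((1 - r e) / (1 - p e))) := by
  rw [Real.exp_sum]
  refine Finset.prod_congr rfl fun e he => ?_
  have h1 := hp e he
  have h2 := hr e he
  split_ifs
  · rw [Real.exp_log (div_pos h2.1 h1.1)]
  · rw [Real.exp_log (div_pos (by linarith) (by linarith))]

/-- Lower bound for the probability, under `p`, that the alternative `r` looks almost as likely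
as `p`. By Rolle's theorem the moment generating function of the log-likelihood ratio `L`, which is
`1` at both ends of `[0, 1]`, has a critical point `s`; under the law tilted by `exp (s * L)` the
mean of `L` vanishes, so that `|L| ≤ t` with probability at least `1 - V / t ^ 2` there. -/
theorem le_prob_likelihoodRatio_ge (hp : ∀ e ∈ E, 0 < p e ∧ p e < 1)
    (hr : ∀ e ∈ E, 0 < r e ∧ r e < 1) {F V t : ℝ} (ht : 0 < t)
    (hF : ∀ s ∈ Set.Ioo (0 : ℝ) 1, F ≤ ∏ e ∈ E, affinity s (p e) (r e))
    (hV : ∀ s ∈ Set.Ioo (0 : ℝ) 1, ∑ e ∈ E, (tiltedMean s (p e) (r e) * Real.log (r e / p e) ^ 2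
      + Real.log ((1 - r e) / (1 - p e)) ^ 2) ≤ V)
    (hVt : V ≤ t ^ 2 / 2) :
    F * Real.exp (-t) / 2 ≤
      bernoulliExp E p fun H => if Real.exp (-t) ≤ likelihoodRatio E p r H then 1 else 0 := by
  set a : ι → ℝ := fun e => Real.log (r e / p e) with ha
  set b : ι → ℝ := fun e => Real.log ((1 - r e) / (1 - p e)) with hb
  set L : Finset ι → ℝ := fun H => ∑ e ∈ E, if e ∈ H then a e else b e with hL
  have hexp : ∀ s H, Real.exp (s * L H)
      = ∏ e ∈ E, if e ∈ H then Real.exp (s * a e) else Real.exp (s * b e) := by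
    intro s H
    rw [hL, Finset.mul_sum, Real.exp_sum]
    exact Finset.prod_congr rfl fun e _ => by split_ifs <;> rfl
  have hpa : ∀ s, ∀ e ∈ E, p e * Real.exp (s * a e) = p e ^ (1 - s) * r e ^ s := fun s e he =>
    mul_exp_mul_log_div (hp e he).1 (hr e he).1
  have hpb : ∀ s, ∀ e ∈ E,
      (1 - p e) * Real.exp (s * b e) = (1 - p e) ^ (1 - s) * (1 - r e) ^ s := fun s e he =>
    mul_exp_mul_log_div (sub_pos.mpr (hp e he).2) (sub_pos.mpr (hr e he).2)
  have hab : ∀ s, ∀ e ∈ E, p e * Real.exp (s * a e) + (1 - p e) * Real.exp (s * b e)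
      = affinity s (p e) (r e) := fun s e he => by rw [hpa s e he, hpb s e he, affinity]
  have htilt : ∀ s (f : Finset ι → ℝ), bernoulliExp E p (fun H => Real.exp (s * L H) * f H)
      = (∏ e ∈ E, affinity s (p e) (r e))
        * bernoulliExp E (fun e => tiltedMean s (p e) (r e)) f := by
    intro s f
    simp only [hexp]
    rw [bernoulliExp_tilt _ _ (fun e he => by
      rw [hab s e he]; exact (affinity_pos (hp e he) (hr e he)).ne'),
      Finset.prod_congr rfl (hab s)]
    congr 1
    refine Finset.sum_congr rfl fun H _ => ?_
    congr 1
    refine Finset.prod_congr rfl fun e he => ?_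
    simp only [hab s e he]
    rw [hpa s e he, tiltedMean]
  have hprod : ∀ s, 0 < ∏ e ∈ E, affinity s (p e) (r e) := fun s =>
    Finset.prod_pos fun e he => affinity_pos (hp e he) (hr e he)
  set M : ℝ → ℝ := fun s => bernoulliExp E p (fun H => Real.exp (s * L H)) with hM
  have hMprod : ∀ s, M s = ∏ e ∈ E, affinity s (p e) (r e) := by
    intro s
    have := htilt s (fun _ => 1)
    simpa [bernoulliExp_one] using this
  have hM0 : M 0 = 1 := by rw [hMprod]; simp [affinity]
  have hM1 : M 1 = 1 := by rw [hMprod]; simp [affinity]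
  have hderiv : ∀ s, HasDerivAt M (bernoulliExp E p (fun H => Real.exp (s * L H) * L H)) s := by
    intro s
    simp only [hM, bernoulliExp]
    refine HasDerivAt.fun_sum fun H _ => ?_
    refine HasDerivAt.const_mul _ ?_
    simpa using ((hasDerivAt_id s).mul_const (L H)).exp
  obtain ⟨s, hs, hs0⟩ := exists_hasDerivAt_eq_zero (f := M) one_pos
    (fun s _ => (hderiv s).continuousAt.continuousWithinAt) (hM0.trans hM1.symm)
    (fun s _ => hderiv s)
  rw [htilt] at hs0
  have hmean : bernoulliExp E (fun e => tiltedMean s (p e) (r e)) L = 0 :=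
    (mul_eq_zero.mp hs0).resolve_left (hprod s).ne'
  have hvar : bernoulliExp E (fun e => tiltedMean s (p e) (r e)) (fun H => L H ^ 2) ≤ V := by
    refine le_trans ?_ (hV s hs)
    have h1 := bernoulliExp_sum_edges_sq (E := E) (p := fun e => tiltedMean s (p e) (r e)) a b
    have h2 := bernoulliExp_sum_edges (E := E) (p := fun e => tiltedMean s (p e) (r e)) a b
    rw [h1, ← h2, hmean]
    simp only [ne_eq, OfNat.ofNat_ne_zero, not_false_eq_true, zero_pow, zero_add]
    refine Finset.sum_le_sum fun e he => ?_
    have h3 := tiltedMean_mem (s := s) (hp e he) (hr e he)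
    -- The variance is at most the second moment.
    nlinarith [sq_nonneg (tiltedMean s (p e) (r e) * a e + (1 - tiltedMean s (p e) (r e)) * b e),
      mul_nonneg h3.1 (sq_nonneg (b e))]
  have hpt : ∀ H, Real.exp (-t) * (Real.exp (s * L H) * (1 - L H ^ 2 / t ^ 2))
      ≤ if Real.exp (-t) ≤ likelihoodRatio E p r H then 1 else 0 := by
    intro H
    rw [likelihoodRatio_eq_exp hp hr]
    change _ ≤ if Real.exp (-t) ≤ Real.exp (L H) then (1 : ℝ) else 0
    rw [← mul_assoc, ← Real.exp_add]
    have hpos := Real.exp_pos (-t + s * L H)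
    by_cases h : |L H| ≤ t
    · rw [if_pos (Real.exp_le_exp.mpr (abs_le.mp h).1)]
      refine mul_le_one₀ (Real.exp_le_one_iff.mpr ?_) ?_ ?_
      · have : s * L H ≤ 1 * t := by
          calc s * L H ≤ s * |L H| := mul_le_mul_of_nonneg_left (le_abs_self _) hs.1.le
            _ ≤ 1 * t := mul_le_mul hs.2.le h (abs_nonneg _) zero_le_one
        linarith
      · rw [sub_nonneg, div_le_one (by positivity)]
        exact sq_le_sq' (abs_le.mp h).1 (abs_le.mp h).2
      · have : 0 ≤ L H ^ 2 / t ^ 2 := by positivity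
        linarith
    · have h1 : 1 ≤ L H ^ 2 / t ^ 2 := by
        rw [one_le_div (by positivity), sq_le_sq, abs_of_pos ht]
        exact (not_le.mp h).le
      have h2 : Real.exp (-t + s * L H) * (1 - L H ^ 2 / t ^ 2) ≤ 0 :=
        mul_nonpos_of_nonneg_of_nonpos hpos.le (by linarith)
      split_ifs <;> linarith
  have hp' : ∀ e ∈ E, 0 ≤ p e ∧ p e ≤ 1 := fun e he => ⟨(hp e he).1.le, (hp e he).2.le⟩
  refine le_trans ?_ (bernoulliExp_mono hp' fun H _ => hpt H)
  rw [bernoulliExp_const_mul, htilt]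
  have h1 : bernoulliExp E (fun e => tiltedMean s (p e) (r e)) (fun H => 1 - L H ^ 2 / t ^ 2)
      = 1 - bernoulliExp E (fun e => tiltedMean s (p e) (r e)) (fun H => L H ^ 2) / t ^ 2 := by
    have h := bernoulliExp_add (E := E) (p := fun e => tiltedMean s (p e) (r e)) (fun _ => 1)
      (fun H => L H ^ 2 * (-(t ^ 2)⁻¹))
    rw [bernoulliExp_one, bernoulliExp_mul_const] at h
    rw [div_eq_mul_inv, sub_eq_add_neg, ← mul_neg, ← h]
    exact bernoulliExp_congr fun H _ => by ring
  rw [h1]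
  have h2 : 1 / 2 ≤ 1 - bernoulliExp E (fun e => tiltedMean s (p e) (r e)) (fun H => L H ^ 2)
      / t ^ 2 := by
    have : bernoulliExp E (fun e => tiltedMean s (p e) (r e)) (fun H => L H ^ 2) / t ^ 2
        ≤ 1 / 2 := by
      rw [div_le_iff₀ (by positivity)]
      linarith
    linarith
  have h3 : F * (1 / 2) ≤ _ :=
    mul_le_mul (hF s hs) h2 (by norm_num) (hprod s).le
  have h4 := mul_le_mul_of_nonneg_left h3 (Real.exp_pos (-t)).le
  linarith

/-- Upper bound for the probability, under `p`, that the alternative `r` looks much less likely,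
by Markov's inequality for the inverse of the likelihood ratio. -/
theorem prob_likelihoodRatio_lt_le (hp : ∀ e ∈ E, 0 < p e ∧ p e < 1)
    (hr : ∀ e ∈ E, 0 < r e ∧ r e < 1) (t : ℝ) :
    bernoulliExp E p (fun H => if likelihoodRatio E p r H < Real.exp (-t) then 1 else 0)
      ≤ Real.exp (-t + ∑ e ∈ E, (p e - r e) ^ 2 / (r e * (1 - r e))) := by
  have hp' : ∀ e ∈ E, 0 ≤ p e ∧ p e ≤ 1 := fun e he => ⟨(hp e he).1.le, (hp e he).2.le⟩
  have hinv : ∀ H, (likelihoodRatio E p r H)⁻¹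
      = ∏ e ∈ E, if e ∈ H then p e / r e else (1 - p e) / (1 - r e) := by
    intro H
    rw [likelihoodRatio, ← Finset.prod_inv_distrib]
    exact Finset.prod_congr rfl fun e _ => by split_ifs <;> rw [inv_div]
  have hpos : ∀ H, 0 < likelihoodRatio E p r H := fun H => by
    rw [likelihoodRatio_eq_exp hp hr]; exact Real.exp_pos _
  have hpt : ∀ H, (if likelihoodRatio E p r H < Real.exp (-t) then (1 : ℝ) else 0)
      ≤ Real.exp (-t) * ∏ e ∈ E, if e ∈ H then p e / r e else (1 - p e) / (1 - r e) := by
    intro H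
    rw [← hinv, ← div_eq_mul_inv]
    split_ifs with h
    · exact (one_le_div (hpos H)).mpr h.le
    · exact (div_pos (Real.exp_pos _) (hpos H)).le
  refine (bernoulliExp_mono hp' fun H _ => hpt H).trans ?_
  rw [bernoulliExp_const_mul, bernoulliExp_prod, Real.exp_add, Real.exp_sum]
  refine mul_le_mul_of_nonneg_left (Finset.prod_le_prod ?_ ?_) (Real.exp_pos _).le
  · intro e he
    have h1 := hp e he
    have h2 := hr e he
    have h3 := sub_pos.mpr h1.2
    have h4 := sub_pos.mpr h2.2
    have := h1.1
    have := h2.1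
    positivity
  · intro e he
    have h1 := hp e he
    have h2 := hr e he
    have h3 : r e ≠ 0 := h2.1.ne'
    have h4 : 1 - r e ≠ 0 := (sub_pos.mpr h2.2).ne'
    have : p e * (p e / r e) + (1 - p e) * ((1 - p e) / (1 - r e))
        = (p e - r e) ^ 2 / (r e * (1 - r e)) + 1 := by
      field_simp; ring
    rw [this]
    exact Real.add_one_le_exp _

theorem likelihoodRatio_inter {A : Finset ι} (p r : ι → ℝ) (H : Finset ι) :
    likelihoodRatio A p r (H ∩ A) = likelihoodRatio A p r H :=
  Finset.prod_congr rfl fun e he => by simp [he]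

open Classical in
/-- If the events `F v`, `v ∈ S`, depend on disjoint sets of edges and have probability at
least `p₀`, then with high probability many of them occur, even after discarding those `v` for which
an unlikely event `G v`, independent of `F v`, occurs as well. The events `G v` may depend on each
other: Chebyshev's inequality is used for the `F v` and Markov's inequality for the `F v ∩ G v`. -/
theorem prob_card_lt_le {V : Type*} (hp : ∀ e ∈ E, 0 ≤ p e ∧ p e ≤ 1) (S : Finset V)
    (F G : V → Finset ι → Prop) (A B : V → Finset ι)
    (hA : ∀ v ∈ S, A v ⊆ E) (hB : ∀ v ∈ S, B v ⊆ E)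
    (hF : ∀ v ∈ S, ∀ H, F v H ↔ F v (H ∩ A v)) (hG : ∀ v ∈ S, ∀ H, G v H ↔ G v (H ∩ B v))
    (hAA : ∀ u ∈ S, ∀ v ∈ S, u ≠ v → Disjoint (A u) (A v))
    (hAB : ∀ v ∈ S, Disjoint (A v) (B v))
    {p₀ β : ℝ} (hp₀ : ∀ v ∈ S, p₀ ≤ bernoulliExp E p (fun H => if F v H then 1 else 0))
    (hβ : ∀ v ∈ S, bernoulliExp E p (fun H => if G v H then 1 else 0) ≤ β)
    (hpos : 0 < (S.card : ℝ) * p₀) :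
    bernoulliExp E p (fun H =>
        if ((S.filter fun v => F v H ∧ ¬ G v H).card : ℝ) < S.card * p₀ / 4 then 1 else 0)
      ≤ 4 / (S.card * p₀) + 4 * β := by
  set φ : V → Finset ι → ℝ := fun v H => if F v H then 1 else 0 with hφ
  set γ : V → Finset ι → ℝ := fun v H => if G v H then 1 else 0 with hγ
  set P : V → ℝ := fun v => bernoulliExp E p (φ v) with hP
  set μ : ℝ := ∑ v ∈ S, P v with hμ
  have hμ0 : (S.card : ℝ) * p₀ ≤ μ := by
    rw [← nsmul_eq_mul]; exact Finset.card_nsmul_le_sum _ _ _ hp₀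
  have hμpos : 0 < μ := hpos.trans_le hμ0
  have hφloc : ∀ v ∈ S, ∀ H, φ v H = φ v (H ∩ A v) := fun v hv H => by
    simp only [hφ]; exact if_congr (hF v hv H) rfl rfl
  have hγloc : ∀ v ∈ S, ∀ H, γ v H = γ v (H ∩ B v) := fun v hv H => by
    simp only [hγ]; exact if_congr (hG v hv H) rfl rfl
  have hvar : bernoulliExp E p (fun H => (∑ v ∈ S, φ v H - μ) ^ 2) ≤ μ := by
    have h1 : ∀ H, (∑ v ∈ S, φ v H - μ) ^ 2
        = ∑ u ∈ S, ∑ v ∈ S, (φ u H - P u) * (φ v H - P v) := by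
      intro H
      rw [hμ, ← Finset.sum_sub_distrib, sq, Finset.sum_mul_sum]
    have h0 : ∀ u, bernoulliExp E p (fun H => φ u H - P u) = 0 := by
      intro u
      have := bernoulliExp_add (E := E) (p := p) (φ u) (fun _ => - P u)
      rw [bernoulliExp_const] at this
      simpa [sub_eq_add_neg, hP] using this
    simp only [h1]
    rw [bernoulliExp_sum]
    refine Finset.sum_le_sum fun u hu => ?_
    rw [bernoulliExp_sum, Finset.sum_eq_single_of_mem u hu]
    · have h2 : ∀ H, (φ u H - P u) * (φ u H - P u) = φ u H * (1 - 2 * P u) + P u ^ 2 := by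
        intro H
        have : φ u H * φ u H = φ u H := by simp [hφ]
        linear_combination this
      simp only [h2]
      rw [bernoulliExp_add, bernoulliExp_mul_const, bernoulliExp_const]
      change P u * (1 - 2 * P u) + P u ^ 2 ≤ P u
      nlinarith [sq_nonneg (P u)]
    · intro v hv hvu
      rw [bernoulliExp_mul (hA u hu) (hA v hv) (hAA u hu v hv hvu.symm)
        (fun H => by rw [hφloc u hu H]) (fun H => by rw [hφloc v hv H]), h0, zero_mul]
  have hboth : bernoulliExp E p (fun H => ∑ v ∈ S, φ v H * γ v H) ≤ μ * β := by
    rw [bernoulliExp_sum, hμ, Finset.sum_mul]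
    refine Finset.sum_le_sum fun v hv => ?_
    rw [bernoulliExp_mul (hA v hv) (hB v hv) (hAB v hv) (hφloc v hv) (hγloc v hv)]
    refine mul_le_mul_of_nonneg_left (hβ v hv) ?_
    have := bernoulliExp_mono (f := fun _ => (0 : ℝ)) (g := φ v) hp
      (fun H _ => by simp only [hφ]; split_ifs <;> norm_num)
    rwa [bernoulliExp_const] at this
  have hcard : ∀ H, ((S.filter fun v => F v H ∧ ¬ G v H).card : ℝ)
      = ∑ v ∈ S, φ v H - ∑ v ∈ S, φ v H * γ v H := by
    intro H
    rw [Finset.card_filter, Nat.cast_sum, ← Finset.sum_sub_distrib]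
    refine Finset.sum_congr rfl fun v _ => ?_
    by_cases h1 : F v H <;> by_cases h2 : G v H <;> simp [hφ, hγ, h1, h2]
  have hpt : ∀ H, (if ((S.filter fun v => F v H ∧ ¬ G v H).card : ℝ) < S.card * p₀ / 4
      then (1 : ℝ) else 0)
      ≤ (∑ v ∈ S, φ v H - μ) ^ 2 * (4 / μ ^ 2) + (∑ v ∈ S, φ v H * γ v H) * (4 / μ) := by
    intro H
    have hn1 : 0 ≤ ∑ v ∈ S, φ v H * γ v H := Finset.sum_nonneg fun v _ => by
      simp only [hφ, hγ]; split_ifs <;> norm_num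
    have hn2 : 0 ≤ (∑ v ∈ S, φ v H * γ v H) * (4 / μ) := by positivity
    have hn3 : 0 ≤ (∑ v ∈ S, φ v H - μ) ^ 2 * (4 / μ ^ 2) := by positivity
    split_ifs with h
    · rw [hcard] at h
      by_cases h2 : μ / 4 ≤ ∑ v ∈ S, φ v H * γ v H
      · have : 1 ≤ (∑ v ∈ S, φ v H * γ v H) * (4 / μ) := by
          calc 1 = μ / 4 * (4 / μ) := by field_simp
            _ ≤ _ := mul_le_mul_of_nonneg_right h2 (by positivity)
        linarith
      · have h3 : μ / 2 ≤ μ - ∑ v ∈ S, φ v H := by linarith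
        have : 1 ≤ (∑ v ∈ S, φ v H - μ) ^ 2 * (4 / μ ^ 2) := by
          calc 1 = (μ / 2) ^ 2 * (4 / μ ^ 2) := by field_simp; norm_num
            _ ≤ (μ - ∑ v ∈ S, φ v H) ^ 2 * (4 / μ ^ 2) := by gcongr
            _ = _ := by ring
        linarith
    · linarith
  refine (bernoulliExp_mono hp fun H _ => hpt H).trans ?_
  rw [bernoulliExp_add, bernoulliExp_mul_const, bernoulliExp_mul_const]
  refine add_le_add ?_ ?_
  · calc _ ≤ μ * (4 / μ ^ 2) := mul_le_mul_of_nonneg_right hvar (by positivity)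
      _ = 4 / μ := by field_simp
      _ ≤ _ := by gcongr
  · calc _ ≤ μ * β * (4 / μ) := mul_le_mul_of_nonneg_right hboth (by positivity)
      _ = 4 * β := by field_simp

end Test

/-! ### Estimates for a single edge -/

/-- The gap between the weighted arithmetic and geometric means of `x` and `y`: the summand of the
generalized Chernoff–Hellinger divergence. -/
noncomputable def meanGap (t x y : ℝ) : ℝ :=
  t * x + (1 - t) * y - x ^ t * y ^ (1 - t)

theorem meanGap_nonneg {t x y : ℝ} (ht : t ∈ Set.Icc (0 : ℝ) 1) (hx : 0 ≤ x) (hy : 0 ≤ y) :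
    0 ≤ meanGap t x y :=
  sub_nonneg.mpr (Real.geom_mean_le_arith_mean2_weighted ht.1 (by linarith [ht.2]) hx hy (by ring))

theorem meanGap_mul {t x y c : ℝ} (hx : 0 ≤ x) (hy : 0 ≤ y) (hc : 0 < c) :
    meanGap t (x * c) (y * c) = meanGap t x y * c := by
  have : c ^ t * c ^ (1 - t) = c := by rw [← Real.rpow_add hc]; simp
  rw [meanGap, meanGap, Real.mul_rpow hx hc.le, Real.mul_rpow hy hc.le]
  linear_combination (-(x ^ t * y ^ (1 - t))) * this

theorem meanGap_half {x y : ℝ} (hx : 0 ≤ x) (hy : 0 ≤ y) :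
    meanGap (1 / 2) x y = (√x - √y) ^ 2 / 2 := by
  have h : (1 : ℝ) - 1 / 2 = 1 / 2 := by norm_num
  rw [meanGap, h, ← Real.sqrt_eq_rpow, ← Real.sqrt_eq_rpow]
  linear_combination (-(1 : ℝ) / 2) * Real.sq_sqrt hx - (1 / 2) * Real.sq_sqrt hy

/-- The weighted geometric mean is at least the weighted harmonic mean, which differs from the
arithmetic mean by a multiple of `(x - y) ^ 2`. -/
theorem meanGap_le_sq {t x y : ℝ} (ht : t ∈ Set.Icc (0 : ℝ) 1) (hx : 1 / 2 ≤ x) (hy : 1 / 2 ≤ y) :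
    meanGap t x y ≤ (x - y) ^ 2 / 2 := by
  have hx0 : 0 < x := by linarith
  have hy0 : 0 < y := by linarith
  obtain ⟨h0, h1⟩ := ht
  have hg := Real.geom_mean_le_arith_mean2_weighted h0 (by linarith : 0 ≤ 1 - t)
    (inv_nonneg.mpr hx0.le) (inv_nonneg.mpr hy0.le) (by ring)
  rw [Real.inv_rpow hx0.le, Real.inv_rpow hy0.le, ← mul_inv] at hg
  have hG : 0 < x ^ t * y ^ (1 - t) := by positivity
  have hD : 1 / 2 ≤ t * y + (1 - t) * x := by nlinarith
  have hD0 : 0 < t * y + (1 - t) * x := by linarith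
  have hharm : t * x⁻¹ + (1 - t) * y⁻¹ = (t * y + (1 - t) * x) / (x * y) := by
    field_simp
  rw [hharm, inv_eq_one_div, div_le_div_iff₀ hG (by positivity), one_mul] at hg
  have hge : x * y / (t * y + (1 - t) * x) ≤ x ^ t * y ^ (1 - t) := by
    rw [div_le_iff₀ hD0]; linarith
  have hid : t * x + (1 - t) * y - x * y / (t * y + (1 - t) * x)
      = t * (1 - t) * (x - y) ^ 2 / (t * y + (1 - t) * x) := by
    rw [eq_div_iff hD0.ne', sub_mul, div_mul_cancel₀ _ hD0.ne']; ring
  have hle : t * (1 - t) * (x - y) ^ 2 / (t * y + (1 - t) * x) ≤ (x - y) ^ 2 / 2 := by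
    rw [div_le_iff₀ hD0]
    have h4 : t * (1 - t) ≤ 1 / 4 := by nlinarith [sq_nonneg (t - 1 / 2)]
    nlinarith [mul_le_mul_of_nonneg_right h4 (sq_nonneg (x - y)),
      mul_le_mul_of_nonneg_left hD (sq_nonneg (x - y))]
  rw [meanGap]
  linarith

theorem sq_sub_le_sqrt {p r : ℝ} (hp : 0 ≤ p) (hr : 0 ≤ r) :
    (p - r) ^ 2 ≤ 2 * (p + r) * (√p - √r) ^ 2 := by
  have h1 := Real.sq_sqrt hp
  have h2 := Real.sq_sqrt hr
  have h3 : (p - r) ^ 2 = (√p + √r) ^ 2 * (√p - √r) ^ 2 := by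
    nth_rewrite 1 [← h1, ← h2]; ring
  rw [h3]
  refine mul_le_mul_of_nonneg_right ?_ (sq_nonneg _)
  nlinarith [sq_nonneg (√p - √r)]

theorem sq_sub_le_sqrt_of_le {p r R : ℝ} (hp : 0 ≤ p) (hr : 0 ≤ r) (h : p ≤ R * r) :
    (p - r) ^ 2 ≤ 2 * (R + 1) * r * (√p - √r) ^ 2 := by
  refine (sq_sub_le_sqrt hp hr).trans (mul_le_mul_of_nonneg_right ?_ (sq_nonneg _))
  linarith

theorem chiSq_le {p r R : ℝ} (hp : 0 ≤ p) (hr : 0 < r) (hr2 : r ≤ 1 / 2) (h : p ≤ R * r) :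
    (p - r) ^ 2 / (r * (1 - r)) ≤ 4 * (R + 1) * (√p - √r) ^ 2 := by
  have h1 := sq_sub_le_sqrt_of_le hp hr.le h
  have h2 : 0 < r * (1 - r) := mul_pos hr (by linarith)
  have hR : 0 ≤ R := by
    by_contra hR
    nlinarith
  rw [div_le_iff₀ h2]
  refine h1.trans ?_
  have h3 : 0 ≤ 2 * (R + 1) * r * (√p - √r) ^ 2 := by positivity
  nlinarith

theorem log_div_sq_le {x y m : ℝ} (hm : 0 < m) (hx : m ≤ x) (hy : m ≤ y) :
    Real.log (x / y) ^ 2 ≤ (x - y) ^ 2 / m ^ 2 := by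
  have hx0 := hm.trans_le hx
  have hy0 := hm.trans_le hy
  rw [← div_pow]
  have aux : ∀ a b : ℝ, m ≤ a → m ≤ b → Real.log (a / b) ≤ |a - b| / m := by
    intro a b ha hb
    have hb0 := hm.trans_le hb
    calc Real.log (a / b) ≤ a / b - 1 := Real.log_le_sub_one_of_pos (div_pos (hm.trans_le ha) hb0)
      _ = (a - b) / b := by field_simp
      _ ≤ |a - b| / b := by gcongr; exact le_abs_self _
      _ ≤ |a - b| / m := by gcongr
  rw [sq_le_sq, abs_div, abs_of_pos hm, abs_le]
  refine ⟨?_, aux x y hx hy⟩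
  have := aux y x hy hx
  rw [← inv_div, Real.log_inv, abs_sub_comm] at this
  linarith

theorem half_le_geom_mean {s x y : ℝ} (hs : s ∈ Set.Ioo (0 : ℝ) 1) (hx : 1 / 2 ≤ x)
    (hy : 1 / 2 ≤ y) : 1 / 2 ≤ x ^ (1 - s) * y ^ s := by
  calc (1 / 2 : ℝ) = (1 / 2 : ℝ) ^ (1 - s) * (1 / 2 : ℝ) ^ s := by
        rw [← Real.rpow_add (by norm_num)]; simp
    _ ≤ _ := by
        have := hs.1.le
        have : 0 ≤ 1 - s := by linarith [hs.2]
        gcongr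

/-- The second moment of the contribution of one edge to the log-likelihood ratio, under any law on
the geometric path, is at most a constant times the squared Hellinger distance. -/
theorem tilted_second_moment_le {p r R s : ℝ} (hs : s ∈ Set.Ioo (0 : ℝ) 1) (hp : 0 < p)
    (hr : 0 < r) (hp2 : p ≤ 1 / 2) (hr2 : r ≤ 1 / 2) (hpr : p ≤ R * r) (hrp : r ≤ R * p)
    (hR : 1 ≤ R) :
    tiltedMean s p r * Real.log (r / p) ^ 2 + Real.log ((1 - r) / (1 - p)) ^ 2
      ≤ 8 * R * (R + 1) * (√p - √r) ^ 2 := by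
  set d := (√p - √r) ^ 2 with hd
  have hd0 : 0 ≤ d := sq_nonneg _
  have h1 := sq_sub_le_sqrt_of_le hp.le hr.le hpr
  have h1' := sq_sub_le_sqrt_of_le hr.le hp.le hrp
  rw [← hd] at h1
  have hd' : (√r - √p) ^ 2 = d := by rw [hd]; ring
  rw [hd'] at h1'
  set m := min p r with hm
  have hm0 : 0 < m := lt_min hp hr
  have h2 : (r - p) ^ 2 ≤ 2 * (R + 1) * m * d := by
    rcases min_choice p r with h | h
    · rw [hm, h]; exact h1'
    · rw [hm, h]; linarith
  have hb : Real.log ((1 - r) / (1 - p)) ^ 2 ≤ 4 * R * (R + 1) * d := by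
    refine (log_div_sq_le (m := 1 / 2) (by norm_num) (by linarith) (by linarith)).trans ?_
    have : (1 - r - (1 - p)) ^ 2 / (1 / 2) ^ 2 = 4 * (r - p) ^ 2 := by ring
    rw [this]
    have h3 : 2 * (R + 1) * m * d ≤ 2 * (R + 1) * (1 / 2) * d := by
      gcongr; exact (min_le_left _ _).trans hp2
    have h4 : 0 ≤ (R - 1) * (R + 1) * d := by
      have : 0 ≤ R - 1 := by linarith
      positivity
    nlinarith
  have hT : tiltedMean s p r ≤ 2 * (R * m) := by
    have h3 : p ^ (1 - s) * r ^ s ≤ R * m := by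
      refine (Real.geom_mean_le_arith_mean2_weighted (by linarith [hs.2]) hs.1.le hp.le hr.le
        (by ring)).trans ?_
      have e1 : p ≤ R * m := by
        rcases min_choice p r with h | h
        · rw [hm, h]; nlinarith
        · rw [hm, h]; exact hpr
      have e2 : r ≤ R * m := by
        rcases min_choice p r with h | h
        · rw [hm, h]; exact hrp
        · rw [hm, h]; nlinarith
      nlinarith [hs.1, hs.2]
    have h4 : 1 / 2 ≤ affinity s p r := by
      have := half_le_geom_mean hs (by linarith : 1 / 2 ≤ 1 - p) (by linarith : 1 / 2 ≤ 1 - r)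
      have : 0 < p ^ (1 - s) * r ^ s := by positivity
      unfold affinity
      linarith
    rw [tiltedMean, div_le_iff₀ (by linarith)]
    have : 0 ≤ R * m := by positivity
    nlinarith
  have ha : tiltedMean s p r * Real.log (r / p) ^ 2 ≤ 4 * R * (R + 1) * d := by
    have h3 := log_div_sq_le (x := r) (y := p) hm0 (min_le_right _ _) (min_le_left _ _)
    calc tiltedMean s p r * Real.log (r / p) ^ 2
        ≤ 2 * (R * m) * ((r - p) ^ 2 / m ^ 2) := by gcongr
      _ ≤ 2 * (R * m) * (2 * (R + 1) * m * d / m ^ 2) := by gcongr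
      _ = 4 * R * (R + 1) * d := by field_simp; ring
  linarith

/-- For small `p` and `r` the affinity is governed by the gap between the means of `p` and `r`: the
non-edges contribute only `(p - r) ^ 2`, which is of lower order than the squared Hellinger
distance. -/
theorem exp_le_affinity {p r s θ : ℝ} (hs : s ∈ Set.Ioo (0 : ℝ) 1) (hp : 0 < p) (hr : 0 < r)
    (hpθ : p ≤ θ) (hrθ : r ≤ θ) (hθ : θ ≤ 1 / 4) :
    Real.exp (-((1 + 4 * θ) * (meanGap (1 - s) p r + 2 * θ * (√p - √r) ^ 2)))
      ≤ affinity s p r := by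
  have hs' : 1 - s ∈ Set.Icc (0 : ℝ) 1 := ⟨by linarith [hs.2], by linarith [hs.1]⟩
  set d := (√p - √r) ^ 2 with hd
  have hd0 : 0 ≤ d := sq_nonneg _
  have h1 := sq_sub_le_sqrt hp.le hr.le
  rw [← hd] at h1
  have h2 := meanGap_le_sq hs' (by linarith : 1 / 2 ≤ 1 - p) (by linarith : 1 / 2 ≤ 1 - r)
  have hg0 := meanGap_nonneg hs' hp.le hr.le
  have haff : affinity s p r = 1 - meanGap (1 - s) p r - meanGap (1 - s) (1 - p) (1 - r) := by
    rw [affinity, meanGap, meanGap, sub_sub_cancel]; ring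
  have h3 : (1 - p - (1 - r)) ^ 2 = (p - r) ^ 2 := by ring
  rw [h3] at h2
  set y := meanGap (1 - s) p r + (p - r) ^ 2 / 2 with hy
  have hyd : y ≤ meanGap (1 - s) p r + 2 * θ * d := by
    have : 2 * (p + r) * d ≤ 2 * (θ + θ) * d := by gcongr
    rw [hy]; linarith
  have hy0 : 0 ≤ y := by positivity
  have hyθ : y ≤ 2 * θ := by
    have e1 : meanGap (1 - s) p r ≤ θ := by
      have : 0 < p ^ (1 - s) * r ^ (1 - (1 - s)) := by positivity
      rw [meanGap]
      nlinarith [hs.1, hs.2]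
    have e2 : (p - r) ^ 2 ≤ θ ^ 2 := by
      rw [sq_le_sq, abs_le, abs_of_pos (by linarith)]
      constructor <;> linarith
    rw [hy]
    nlinarith
  have hexp : Real.exp (-((1 + 4 * θ) * y)) ≤ 1 - y := by
    have e1 : 0 < 1 - y := by linarith
    have e2 := Real.one_sub_inv_le_log_of_pos e1
    rw [← Real.le_log_iff_exp_le e1]
    refine le_trans ?_ e2
    have : 1 - (1 - y)⁻¹ = -(y / (1 - y)) := by field_simp; ring
    rw [this, neg_le_neg_iff, div_le_iff₀ e1]
    nlinarith [mul_nonneg hy0 (by linarith : 0 ≤ 2 * θ - y), mul_nonneg hy0 hy0,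
      mul_nonneg (mul_nonneg hy0 hy0) (by linarith : 0 ≤ θ)]
  calc _ ≤ Real.exp (-((1 + 4 * θ) * y)) := by
        rw [Real.exp_le_exp, neg_le_neg_iff]
        have : 0 ≤ 1 + 4 * θ := by linarith
        gcongr
    _ ≤ 1 - y := hexp
    _ ≤ affinity s p r := by rw [haff, hy]; linarith


/-! ### Counting hyperedges -/

section Counting

variable {K n : ℕ}

theorem sum_counts (z : Fin n → Fin K) (e : Finset (Fin n)) : ∑ l, counts z e l = e.card :=
  (Finset.card_eq_sum_card_fiberwise fun v _ => Finset.mem_univ (z v)).symm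

theorem counts_mem_weakComps (z : Fin n → Fin K) (e : Finset (Fin n)) :
    counts z e ∈ weakComps K e.card := by
  simp [weakComps, Finset.mem_piAntidiag, sum_counts]

theorem bump_mem_weakComps {m : ℕ} (hm : 1 ≤ m) (j : Fin K) {w : Fin K → ℕ}
    (hw : w ∈ weakComps K (m - 1)) : bump j w ∈ weakComps K m := by
  simp only [weakComps, Finset.mem_piAntidiag, Finset.mem_univ, implies_true, and_true] at hw ⊢
  rw [bump, Finset.sum_update_of_mem (Finset.mem_univ j)]
  have := Finset.add_sum_erase Finset.univ w (Finset.mem_univ j)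
  have hw' : ∑ l, w l = m - 1 := hw
  rw [Finset.sdiff_singleton_eq_erase]
  omega

theorem counts_eq_bump (z : Fin n → Fin K) {e : Finset (Fin n)} {v : Fin n} (hv : v ∈ e) :
    counts z e = bump (z v) (counts z (e.erase v)) := by
  funext l
  rw [bump, Function.update_apply]
  have h : e.filter (fun u => z u = l) = if z v = l then
      insert v ((e.erase v).filter fun u => z u = l)
      else (e.erase v).filter fun u => z u = l := by
    conv_lhs => rw [← Finset.insert_erase hv]
    rw [Finset.filter_insert]
  simp only [counts]
  rw [h]
  by_cases hl : z v = l
  · rw [if_pos hl, if_pos hl.symm, Finset.card_insert_of_notMem (by simp), hl]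
  · rw [if_neg hl, if_neg (Ne.symm hl)]

theorem counts_update_of_notMem (z : Fin n → Fin K) {e : Finset (Fin n)} {v : Fin n} (k : Fin K)
    (hv : v ∉ e) : counts (Function.update z v k) e = counts z e := by
  funext l
  simp only [counts]
  congr 1
  refine Finset.filter_congr fun u hu => ?_
  have : u ≠ v := fun h => hv (h ▸ hu)
  rw [Function.update_of_ne this]

theorem counts_update_of_mem (z : Fin n → Fin K) {e : Finset (Fin n)} {v : Fin n} (k : Fin K)
    (hv : v ∈ e) : counts (Function.update z v k) e = bump k (counts z (e.erase v)) := by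
  rw [counts_eq_bump _ hv, counts_update_of_notMem _ _ (Finset.notMem_erase v e)]
  simp

theorem card_counts_eq_le (z : Fin n → Fin K) (w : Fin K → ℕ) :
    (Finset.univ.filter fun e : Finset (Fin n) => counts z e = w).card
      ≤ ∏ l, (counts z Finset.univ l).choose (w l) := by
  have h : (Fintype.piFinset fun l =>
      (Finset.univ.filter fun v => z v = l).powersetCard (w l)).card
      = ∏ l, (counts z Finset.univ l).choose (w l) := by
    rw [Fintype.card_piFinset]
    exact Finset.prod_congr rfl fun l _ => by rw [Finset.card_powersetCard, counts]
  rw [← h]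
  refine Finset.card_le_card_of_injOn (fun e l => e.filter fun v => z v = l) ?_ ?_
  · intro e he
    simp only [Finset.coe_filter, Finset.mem_univ, true_and, Set.mem_ofPred_eq] at he
    simp only [Finset.mem_coe, Fintype.mem_piFinset, Finset.mem_powersetCard]
    exact fun l => ⟨Finset.filter_subset_filter _ (Finset.subset_univ e), congrFun he l⟩
  · intro e _ e' _ h
    ext v
    have := congrFun h (z v)
    simp only [Finset.ext_iff, Finset.mem_filter] at this
    simpa using this v

theorem card_superset_le (T : Finset (Fin n)) (m : ℕ) :
    (Finset.univ.filter fun e : Finset (Fin n) => T ⊆ e ∧ e.card = m).card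
      ≤ (n - T.card).choose (m - T.card) := by
  have h : ((Finset.univ \ T).powersetCard (m - T.card)).card
      = (n - T.card).choose (m - T.card) := by
    rw [Finset.card_powersetCard, Finset.card_sdiff_of_subset (Finset.subset_univ T)]
    simp
  rw [← h]
  refine Finset.card_le_card_of_injOn (fun e => e \ T) ?_ ?_
  · intro e he
    simp only [Finset.coe_filter, Finset.mem_univ, true_and, Set.mem_ofPred_eq] at he
    simp only [Finset.mem_coe, Finset.mem_powersetCard]
    exact ⟨Finset.sdiff_subset_sdiff (Finset.subset_univ e) subset_rfl,
      by rw [Finset.card_sdiff_of_subset he.1, he.2]⟩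
  · intro e he e' he' h
    simp only [Finset.coe_filter, Finset.mem_univ, true_and, Set.mem_ofPred_eq] at he he'
    rw [← Finset.sdiff_union_of_subset he.1, ← Finset.sdiff_union_of_subset he'.1]
    exact congrArg (· ∪ T) h

theorem sum_superset_le (M : Finset ℕ) (T : Finset (Fin n)) (h : ℕ → ℝ) (h0 : ∀ m ∈ M, 0 ≤ h m) :
    ∑ e ∈ (possibleEdges M n).filter (fun e => T ⊆ e), h e.card
      ≤ ∑ m ∈ M, ((n - T.card).choose (m - T.card) : ℝ) * h m := by
  have hmaps : ∀ e ∈ (possibleEdges M n).filter (fun e => T ⊆ e), e.card ∈ M := fun e he => by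
    simpa [possibleEdges] using (Finset.mem_filter.mp he).1
  rw [← Finset.sum_fiberwise_of_maps_to hmaps]
  refine Finset.sum_le_sum fun m hm => ?_
  rw [Finset.sum_congr rfl fun e he => by rw [(Finset.mem_filter.mp he).2], Finset.sum_const,
    nsmul_eq_mul]
  refine mul_le_mul_of_nonneg_right ?_ (h0 m hm)
  norm_cast
  refine le_trans (Finset.card_le_card ?_) (card_superset_le T m)
  intro e he
  simp only [Finset.mem_filter] at he
  simp [he.1.2, he.2]

/-- A sum over the hyperedges through `v` of a function of the type of the remaining vertices. -/
theorem sum_edges_through_le (M : Finset ℕ) (z : Fin n → Fin K) (v : Fin n)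
    (g : ℕ → (Fin K → ℕ) → ℝ) (h0 : ∀ m ∈ M, ∀ w ∈ weakComps K (m - 1), 0 ≤ g m w) :
    ∑ e ∈ (possibleEdges M n).filter (fun e => v ∈ e), g e.card (counts z (e.erase v))
      ≤ ∑ m ∈ M, ∑ w ∈ weakComps K (m - 1),
        ((∏ l, (counts z Finset.univ l).choose (w l) : ℕ) : ℝ) * g m w := by
  set s := (possibleEdges M n).filter (fun e => v ∈ e) with hs
  have hmem : ∀ e ∈ s, e.card ∈ M ∧ v ∈ e := fun e he => by
    simpa [hs, possibleEdges] using he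
  let ty : Finset (Fin n) → (_ : ℕ) × (Fin K → ℕ) := fun e => ⟨e.card, counts z (e.erase v)⟩
  have hmaps : ∀ e ∈ s, ty e ∈ M.sigma fun m => weakComps K (m - 1) := fun e he => by
    have := hmem e he
    refine Finset.mem_sigma.mpr ⟨this.1, ?_⟩
    change counts z (e.erase v) ∈ weakComps K (e.card - 1)
    rw [← Finset.card_erase_of_mem this.2]
    exact counts_mem_weakComps z _
  rw [← Finset.sum_fiberwise_of_maps_to hmaps, Finset.sum_sigma]
  refine Finset.sum_le_sum fun m hm => Finset.sum_le_sum fun w hw => ?_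
  have hty : ∀ e, ty e = ⟨m, w⟩ → e.card = m ∧ counts z (e.erase v) = w := fun e he => by
    simp only [ty, Sigma.mk.injEq, heq_eq_eq] at he
    exact he
  rw [Finset.sum_congr rfl fun e he => by
      rw [(hty e (Finset.mem_filter.mp he).2).1, (hty e (Finset.mem_filter.mp he).2).2],
    Finset.sum_const, nsmul_eq_mul]
  refine mul_le_mul_of_nonneg_right ?_ (h0 m hm w hw)
  norm_cast
  refine le_trans ?_ (card_counts_eq_le z w)
  refine Finset.card_le_card_of_injOn (fun e => e.erase v) ?_ ?_
  · intro e he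
    simp only [Finset.coe_filter, Set.mem_ofPred_eq] at he
    simp [(hty e he.2).2]
  · intro e he e' he' h
    simp only [Finset.coe_filter, Set.mem_ofPred_eq] at he he'
    rw [← Finset.insert_erase (hmem e he.1).2, ← Finset.insert_erase (hmem e' he'.1).2]
    exact congrArg (insert v) h

end Counting

theorem edgeMass_eq_bernoulliMass {K : ℕ} (M : Finset ℕ) (q : ℕ → (Fin K → ℕ) → ℝ) {n : ℕ}
    (z : Fin n → Fin K) (H : Hypergraph n) :
    edgeMass M q z H
      = bernoulliMass (possibleEdges M n) (fun e => q e.card (counts z e)) H := by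
  unfold edgeMass bernoulliMass
  refine Finset.prod_congr rfl fun e _ => ?_
  congr


/-! ### Many confusable vertices, given the labels -/

section Likelihood

variable {ι : Type*} [DecidableEq ι] {E : Finset ι} {p r : ι → ℝ}

theorem bernoulliMass_eq_mul_likelihoodRatio (hp : ∀ e ∈ E, 0 < p e ∧ p e < 1) (H : Finset ι) :
    bernoulliMass E r H = bernoulliMass E p H * likelihoodRatio E p r H := by
  rw [bernoulliMass, bernoulliMass, likelihoodRatio, ← Finset.prod_mul_distrib]
  refine Finset.prod_congr rfl fun e he => ?_
  have h1 := (hp e he).1.ne'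
  have h2 : 1 - p e ≠ 0 := (sub_pos.mpr (hp e he).2).ne'
  split_ifs <;> field_simp

/-- Edges whose probability is not affected do not contribute to the likelihood ratio. -/
theorem likelihoodRatio_eq_mul {A B : Finset ι} (hp : ∀ e ∈ E, 0 < p e ∧ p e < 1)
    (hA : A ⊆ E) (hB : B ⊆ E) (hd : Disjoint A B)
    (h : ∀ e ∈ E, e ∉ A → e ∉ B → r e = p e) (H : Finset ι) :
    likelihoodRatio E p r H = likelihoodRatio A p r H * likelihoodRatio B p r H := by
  rw [likelihoodRatio, likelihoodRatio, likelihoodRatio, ← Finset.prod_union hd]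
  symm
  refine Finset.prod_subset (Finset.union_subset hA hB) fun e he hn => ?_
  rw [Finset.mem_union, not_or] at hn
  have h1 := (hp e he).1.ne'
  have h2 : 1 - p e ≠ 0 := (sub_pos.mpr (hp e he).2).ne'
  rw [h e he hn.1 hn.2, div_self h1, div_self h2, ite_self]

end Likelihood

/-- The weighted size of the hyperedges meeting a set of vertices twice. -/
theorem sum_shared_le {n : ℕ} (M : Finset ℕ) (hM : ∀ m ∈ M, 2 ≤ m) (hn : 2 ≤ n)
    (S : Finset (Fin n)) (v : Fin n) {c : ℝ} (hc : 0 ≤ c) :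
    ∑ e ∈ (possibleEdges M n).filter (fun e => v ∈ e ∧ ∃ u ∈ S, u ≠ v ∧ u ∈ e),
        c / ((n - 1).choose (e.card - 1) : ℝ)
      ≤ S.card * (∑ m ∈ M, (m : ℝ)) / (n - 1) * c := by
  have hn1 : (0 : ℝ) < n - 1 := by
    have : (2 : ℝ) ≤ n := by exact_mod_cast hn
    linarith
  set B := (possibleEdges M n).filter (fun e => v ∈ e ∧ ∃ u ∈ S, u ≠ v ∧ u ∈ e) with hB
  have hf : ∀ e : Finset (Fin n), 0 ≤ c / ((n - 1).choose (e.card - 1) : ℝ) := fun e => by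
    positivity
  have h1 : ∀ u ∈ S.erase v, ∑ e ∈ B, (if u ∈ e then c / ((n - 1).choose (e.card - 1) : ℝ) else 0)
      ≤ (∑ m ∈ M, (m : ℝ)) / (n - 1) * c := by
    intro u hu
    have huv : u ≠ v := Finset.ne_of_mem_erase hu
    rw [← Finset.sum_filter]
    calc _ ≤ ∑ e ∈ (possibleEdges M n).filter (fun e => ({u, v} : Finset (Fin n)) ⊆ e),
          c / ((n - 1).choose (e.card - 1) : ℝ) := by
          refine Finset.sum_le_sum_of_subset_of_nonneg ?_ fun e _ _ => hf e
          intro e he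
          simp only [hB, Finset.mem_filter] at he
          rw [Finset.mem_filter]
          refine ⟨he.1.1, ?_⟩
          intro x hx
          simp only [Finset.mem_insert, Finset.mem_singleton] at hx
          rcases hx with rfl | rfl
          · exact he.2
          · exact he.1.2.1
      _ ≤ ∑ m ∈ M, ((n - 2).choose (m - 2) : ℝ) * (c / ((n - 1).choose (m - 1) : ℝ)) := by
          have := sum_superset_le M ({u, v} : Finset (Fin n))
            (fun m => c / ((n - 1).choose (m - 1) : ℝ)) (fun m _ => by positivity)
          rwa [Finset.card_pair huv] at this
      _ ≤ ∑ m ∈ M, (m : ℝ) / (n - 1) * c := by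
          refine Finset.sum_le_sum fun m hm => ?_
          have hm2 := hM m hm
          by_cases h0 : (n - 1).choose (m - 1) = 0
          · rw [h0]
            simp only [Nat.cast_zero, div_zero, mul_zero]
            positivity
          · have hpos : (0 : ℝ) < ((n - 1).choose (m - 1) : ℝ) := by
              exact_mod_cast Nat.pos_of_ne_zero h0
            have hid : ((n : ℝ) - 1) * ((n - 2).choose (m - 2) : ℝ)
                = ((n - 1).choose (m - 1) : ℝ) * (m - 1) := by
              obtain ⟨n', rfl⟩ := Nat.exists_eq_add_of_le' hn
              obtain ⟨m', rfl⟩ := Nat.exists_eq_add_of_le' hm2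
              have := Nat.add_one_mul_choose_eq n' m'
              have e1 : n' + 2 - 1 = n' + 1 := rfl
              have e2 : m' + 2 - 1 = m' + 1 := rfl
              rw [e1, e2, Nat.add_sub_cancel, Nat.add_sub_cancel]
              push_cast
              have h3 : ((n' + 1 : ℕ) : ℝ) * (n'.choose m' : ℝ)
                  = ((n' + 1).choose (m' + 1) : ℝ) * ((m' + 1 : ℕ) : ℝ) := by exact_mod_cast this
              push_cast at h3
              linear_combination h3
            rw [mul_div_assoc', div_le_iff₀ hpos, mul_comm _ c, div_mul_eq_mul_div,
              div_mul_eq_mul_div, le_div_iff₀ hn1]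
            nlinarith [mul_nonneg hc hpos.le]
      _ = _ := by rw [Finset.sum_div, Finset.sum_mul]
  calc ∑ e ∈ B, c / ((n - 1).choose (e.card - 1) : ℝ)
      ≤ ∑ e ∈ B, ∑ u ∈ S.erase v, (if u ∈ e then c / ((n - 1).choose (e.card - 1) : ℝ) else 0) := by
        refine Finset.sum_le_sum fun e he => ?_
        simp only [hB, Finset.mem_filter] at he
        obtain ⟨u, hu, huv, hue⟩ := he.2.2
        refine le_trans ?_ (Finset.single_le_sum (f := fun u =>
          if u ∈ e then c / ((n - 1).choose (e.card - 1) : ℝ) else 0)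
          (fun x _ => by split_ifs; exacts [hf e, le_rfl]) (Finset.mem_erase.mpr ⟨huv, hu⟩))
        simp [hue]
    _ = ∑ u ∈ S.erase v, ∑ e ∈ B, (if u ∈ e then c / ((n - 1).choose (e.card - 1) : ℝ) else 0) :=
        Finset.sum_comm
    _ ≤ (S.erase v).card • ((∑ m ∈ M, (m : ℝ)) / (n - 1) * c) :=
        Finset.sum_le_card_nsmul _ _ _ h1
    _ ≤ S.card • ((∑ m ∈ M, (m : ℝ)) / (n - 1) * c) :=
        nsmul_le_nsmul_left (by positivity) (Finset.card_le_card (Finset.erase_subset v S))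
    _ = _ := by rw [nsmul_eq_mul]; ring

open Classical in
/-- Fix labels `z` and a set `S` of vertices of community `j`. Most likely, many vertices `v ∈ S`
could be moved to community `k` without reducing the likelihood by more than the factor
`exp (-2t)`. The hyperedges through `v` that avoid the rest of `S` yield independent events for the
different `v`; the remaining hyperedges through `v` carry little information as `S` is small. -/
theorem prob_confusable_card_lt_le {K n : ℕ} (M : Finset ℕ) (hM : ∀ m ∈ M, 2 ≤ m) (hn : 2 ≤ n)
    (q : ℕ → (Fin K → ℕ) → ℝ) (z : Fin n → Fin K) (j k : Fin K) (S : Finset (Fin n))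
    (hS : ∀ v ∈ S, z v = j) {θ R D X t p₀ β : ℝ} (hθ₀ : 0 ≤ θ) (hθ : θ ≤ 1 / 4) (hR : 1 ≤ R) (hD : 0 ≤ D)
    (ht : 0 < t)
    (hq : ∀ m ∈ M, ∀ w ∈ weakComps K m, 0 < q m w ∧ q m w ≤ θ)
    (hjk : ∀ m ∈ M, ∀ w ∈ weakComps K (m - 1), q m (bump j w) ≤ R * q m (bump k w))
    (hkj : ∀ m ∈ M, ∀ w ∈ weakComps K (m - 1), q m (bump k w) ≤ R * q m (bump j w))
    (hd : ∀ m ∈ M, ∀ w ∈ weakComps K (m - 1),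
      (√(q m (bump j w)) - √(q m (bump k w))) ^ 2 ≤ D / ((n - 1).choose (m - 1) : ℝ))
    (hX : ∀ s ∈ Set.Icc (0 : ℝ) 1, ∑ m ∈ M, ∑ w ∈ weakComps K (m - 1),
      ((∏ l, (counts z Finset.univ l).choose (w l) : ℕ) : ℝ)
        * meanGap s (q m (bump j w)) (q m (bump k w)) ≤ X)
    (hV : 8 * R * (R + 1) * (M.card * D) ≤ t ^ 2 / 2)
    (hp₀ : p₀ = Real.exp (-((1 + 4 * θ) * (X + 2 * θ * (M.card * D)))) * Real.exp (-t) / 2)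
    (hβ : β = Real.exp (-t + S.card * (∑ m ∈ M, (m : ℝ)) / (n - 1) * (4 * (R + 1) * D)))
    (hSpos : 0 < S.card) :
    bernoulliExp (possibleEdges M n) (fun e => q e.card (counts z e)) (fun H =>
        if ((S.filter fun v => Real.exp (-(2 * t)) * edgeMass M q z H
          ≤ edgeMass M q (Function.update z v k) H).card : ℝ) < S.card * p₀ / 4 then 1 else 0)
      ≤ 4 / (S.card * p₀) + 4 * β := by
  set E := possibleEdges M n with hE
  set p : Finset (Fin n) → ℝ := fun e => q e.card (counts z e) with hp
  set r : Fin n → Finset (Fin n) → ℝ :=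
    fun v e => q e.card (counts (Function.update z v k) e) with hr
  have hEM : ∀ e ∈ E, e.card ∈ M := fun e he => by simpa [hE, possibleEdges] using he
  have hq1 : ∀ e ∈ E, ∀ z' : Fin n → Fin K,
      0 < q e.card (counts z' e) ∧ q e.card (counts z' e) ≤ θ := fun e he z' =>
    hq _ (hEM e he) _ (counts_mem_weakComps z' e)
  have hp1 : ∀ e ∈ E, 0 < p e ∧ p e < 1 := fun e he =>
    ⟨(hq1 e he z).1, (hq1 e he z).2.trans_lt (by linarith)⟩
  have hr1 : ∀ v, ∀ e ∈ E, 0 < r v e ∧ r v e < 1 := fun v e he =>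
    ⟨(hq1 e he _).1, (hq1 e he _).2.trans_lt (by linarith)⟩
  set A : Fin n → Finset (Finset (Fin n)) :=
    fun v => E.filter fun e => v ∈ e ∧ ∀ u ∈ S, u ≠ v → u ∉ e with hA
  set B : Fin n → Finset (Finset (Fin n)) :=
    fun v => E.filter fun e => v ∈ e ∧ ∃ u ∈ S, u ≠ v ∧ u ∈ e with hB
  have hAE : ∀ v, A v ⊆ E := fun v => Finset.filter_subset _ _
  have hBE : ∀ v, B v ⊆ E := fun v => Finset.filter_subset _ _
  have hAB : ∀ v, Disjoint (A v) (B v) := fun v => by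
    rw [Finset.disjoint_left]
    intro e h1 h2
    obtain ⟨u, hu, huv, hue⟩ := (Finset.mem_filter.mp h2).2.2
    exact (Finset.mem_filter.mp h1).2.2 u hu huv hue
  have hAA : ∀ u ∈ S, ∀ v ∈ S, u ≠ v → Disjoint (A u) (A v) := fun u _ v hv huv => by
    rw [Finset.disjoint_left]
    intro e h1 h2
    exact (Finset.mem_filter.mp h1).2.2 v hv huv.symm (Finset.mem_filter.mp h2).2.1
  have hAthrough : ∀ v, A v ⊆ E.filter fun e => v ∈ e := fun v e he => by
    rw [hA, Finset.mem_filter] at he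
    exact Finset.mem_filter.mpr ⟨he.1, he.2.1⟩
  -- The quantities attached to a hyperedge through a vertex of `S`.
  have hpe : ∀ v ∈ S, ∀ e ∈ E, v ∈ e → p e = q e.card (bump j (counts z (e.erase v))) ∧
      r v e = q e.card (bump k (counts z (e.erase v))) ∧
      counts z (e.erase v) ∈ weakComps K (e.card - 1) := fun v hv e _ hve => by
    refine ⟨?_, ?_, ?_⟩
    · simp only [hp]; rw [counts_eq_bump z hve, hS v hv]
    · simp only [hr]; rw [counts_update_of_mem z k hve]
    · rw [← Finset.card_erase_of_mem hve]; exact counts_mem_weakComps z _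
  have hpr : ∀ v ∈ S, ∀ e ∈ E, v ∈ e → p e ≤ R * r v e ∧ r v e ≤ R * p e ∧
      (√(p e) - √(r v e)) ^ 2 ≤ D / ((n - 1).choose (e.card - 1) : ℝ) := fun v hv e he hve => by
    obtain ⟨h1, h2, h3⟩ := hpe v hv e he hve
    rw [h1, h2]
    exact ⟨hjk _ (hEM e he) _ h3, hkj _ (hEM e he) _ h3, hd _ (hEM e he) _ h3⟩
  -- The total squared Hellinger distance of the hyperedges through `v`.
  have hsumd : ∀ v ∈ S, ∑ e ∈ A v, (√(p e) - √(r v e)) ^ 2 ≤ M.card * D := by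
    intro v hv
    calc ∑ e ∈ A v, (√(p e) - √(r v e)) ^ 2
        ≤ ∑ e ∈ E.filter (fun e => ({v} : Finset (Fin n)) ⊆ e),
          D / ((n - 1).choose (e.card - 1) : ℝ) := by
          refine (Finset.sum_le_sum fun e he =>
            (hpr v hv e (hAE v he) (Finset.mem_filter.mp (hAthrough v he)).2).2.2).trans ?_
          refine Finset.sum_le_sum_of_subset_of_nonneg ?_ fun e _ _ => by positivity
          simpa using hAthrough v
      _ ≤ ∑ m ∈ M, ((n - 1).choose (m - 1) : ℝ) * (D / ((n - 1).choose (m - 1) : ℝ)) := by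
          have := sum_superset_le M ({v} : Finset (Fin n))
            (fun m => D / ((n - 1).choose (m - 1) : ℝ)) (fun m _ => by positivity)
          rwa [Finset.card_singleton] at this
      _ ≤ ∑ m ∈ M, D := by
          refine Finset.sum_le_sum fun m _ => ?_
          by_cases h0 : ((n - 1).choose (m - 1) : ℝ) = 0
          · simpa [h0] using hD
          · rw [mul_div_cancel₀ _ h0]
      _ = _ := by simp
  have hsumX : ∀ v ∈ S, ∀ s ∈ Set.Icc (0 : ℝ) 1, ∑ e ∈ A v, meanGap s (p e) (r v e) ≤ X := by
    intro v hv s hs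
    refine le_trans ?_ (hX s hs)
    refine le_trans ?_ (sum_edges_through_le M z v
      (fun m w => meanGap s (q m (bump j w)) (q m (bump k w))) ?_)
    · refine le_trans (Finset.sum_le_sum_of_subset_of_nonneg (hAthrough v) fun e he _ => ?_) ?_
      · have he' := Finset.mem_filter.mp he
        exact meanGap_nonneg hs (hp1 e he'.1).1.le (hr1 v e he'.1).1.le
      · refine le_of_eq (Finset.sum_congr rfl fun e he => ?_)
        have he' := Finset.mem_filter.mp he
        obtain ⟨h1, h2, _⟩ := hpe v hv e he'.1 he'.2
        rw [h1, h2]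
    · intro m hm w hw
      have hm1 : 1 ≤ m := one_le_two.trans (hM m hm)
      exact meanGap_nonneg hs (hq m hm _ (bump_mem_weakComps hm1 j hw)).1.le
        (hq m hm _ (bump_mem_weakComps hm1 k hw)).1.le
  have hlik : ∀ v ∈ S, ∀ H, edgeMass M q (Function.update z v k) H = edgeMass M q z H
      * (likelihoodRatio (A v) p (r v) H * likelihoodRatio (B v) p (r v) H) := by
    intro v _ H
    rw [edgeMass_eq_bernoulliMass, edgeMass_eq_bernoulliMass,
      ← likelihoodRatio_eq_mul hp1 (hAE v) (hBE v) (hAB v), ← bernoulliMass_eq_mul_likelihoodRatio hp1]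
    intro e he h1 h2
    have hve : v ∉ e := fun hve => by
      have h3 : ¬ ∀ u ∈ S, u ≠ v → u ∉ e := fun h => h1 (Finset.mem_filter.mpr ⟨he, hve, h⟩)
      push Not at h3
      exact h2 (Finset.mem_filter.mpr ⟨he, hve, h3⟩)
    simp only [hp, hr]
    rw [counts_update_of_notMem z k hve]
  have hcount := prob_card_lt_le (fun e he => ⟨(hp1 e he).1.le, (hp1 e he).2.le⟩) S
    (fun v H => Real.exp (-t) ≤ likelihoodRatio (A v) p (r v) H)
    (fun v H => likelihoodRatio (B v) p (r v) H < Real.exp (-t)) A B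
    (fun v _ => hAE v) (fun v _ => hBE v)
    (fun v _ H => by rw [likelihoodRatio_inter]) (fun v _ H => by rw [likelihoodRatio_inter])
    hAA (fun v _ => hAB v) (p₀ := p₀) (β := β) ?_ ?_ ?_
  · refine le_trans (bernoulliExp_mono (fun e he => ⟨(hp1 e he).1.le, (hp1 e he).2.le⟩)
      fun H _ => ?_) hcount
    have hsub : (S.filter fun v => Real.exp (-t) ≤ likelihoodRatio (A v) p (r v) H ∧
        ¬ likelihoodRatio (B v) p (r v) H < Real.exp (-t)).card ≤
        (S.filter fun v => Real.exp (-(2 * t)) * edgeMass M q z H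
          ≤ edgeMass M q (Function.update z v k) H).card := by
      refine Finset.card_le_card fun v hv => ?_
      rw [Finset.mem_filter] at hv ⊢
      refine ⟨hv.1, ?_⟩
      have h0 : 0 ≤ edgeMass M q z H := by
        rw [edgeMass_eq_bernoulliMass]
        exact bernoulliMass_nonneg (fun e he => ⟨(hp1 e he).1.le, (hp1 e he).2.le⟩) H
      have h1 : Real.exp (-(2 * t))
          ≤ likelihoodRatio (A v) p (r v) H * likelihoodRatio (B v) p (r v) H := by
        have : -(2 * t) = -t + -t := by ring
        rw [this, Real.exp_add]
        exact mul_le_mul hv.2.1 (not_lt.mp hv.2.2) (Real.exp_pos _).le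
          ((Real.exp_pos _).le.trans hv.2.1)
      rw [hlik v hv.1, mul_comm]
      exact mul_le_mul_of_nonneg_left h1 h0
    have hsub' : ((S.filter fun v => Real.exp (-t) ≤ likelihoodRatio (A v) p (r v) H ∧
        ¬ likelihoodRatio (B v) p (r v) H < Real.exp (-t)).card : ℝ) ≤
        (S.filter fun v => Real.exp (-(2 * t)) * edgeMass M q z H
          ≤ edgeMass M q (Function.update z v k) H).card := by exact_mod_cast hsub
    split_ifs with h1 h2
    · exact le_rfl
    · exact absurd (hsub'.trans_lt h1) h2
    · exact zero_le_one
    · exact le_rfl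
  · intro v hv
    have hAp : ∀ e ∈ A v, 0 < p e ∧ p e < 1 := fun e he => hp1 e (hAE v he)
    have hAr : ∀ e ∈ A v, 0 < r v e ∧ r v e < 1 := fun e he => hr1 v e (hAE v he)
    rw [bernoulliExp_marginal (hAE v) (fun H => by rw [likelihoodRatio_inter]), hp₀]
    refine le_prob_likelihoodRatio_ge hAp hAr ht ?_ ?_ hV
    · intro s hs
      refine le_trans ?_ (Finset.prod_le_prod (fun e _ => (Real.exp_pos _).le) fun e he =>
        exp_le_affinity hs (hAp e he).1 (hAr e he).1 (hq1 e (hAE v he) z).2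
          (hq1 e (hAE v he) _).2 hθ)
      rw [← Real.exp_sum, Real.exp_le_exp, Finset.sum_neg_distrib, neg_le_neg_iff,
        ← Finset.mul_sum, Finset.sum_add_distrib, ← Finset.mul_sum]
      have h1 := hsumX v hv (1 - s) ⟨by linarith [hs.2], by linarith [hs.1]⟩
      have h2 := hsumd v hv
      gcongr
    · intro s hs
      calc _ ≤ ∑ e ∈ A v, 8 * R * (R + 1) * (√(p e) - √(r v e)) ^ 2 :=
            Finset.sum_le_sum fun e he => by
              have hve := (Finset.mem_filter.mp (hAthrough v he)).2
              have h := hpr v hv e (hAE v he) hve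
              exact tilted_second_moment_le hs (hAp e he).1 (hAr e he).1
                ((hq1 e (hAE v he) z).2.trans (by linarith))
                ((hq1 e (hAE v he) _).2.trans (by linarith)) h.1 h.2.1 hR
        _ ≤ _ := by
            rw [← Finset.mul_sum]
            exact mul_le_mul_of_nonneg_left (hsumd v hv) (by positivity)
  · intro v hv
    have hBp : ∀ e ∈ B v, 0 < p e ∧ p e < 1 := fun e he => hp1 e (hBE v he)
    have hBr : ∀ e ∈ B v, 0 < r v e ∧ r v e < 1 := fun e he => hr1 v e (hBE v he)
    rw [bernoulliExp_marginal (hBE v) (fun H => by rw [likelihoodRatio_inter]), hβ]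
    refine (prob_likelihoodRatio_lt_le hBp hBr t).trans ?_
    rw [Real.exp_le_exp]
    refine add_le_add le_rfl ?_
    refine le_trans (Finset.sum_le_sum fun e he => ?_)
      (sum_shared_le M hM hn S v (c := 4 * (R + 1) * D) (by positivity))
    have he' := Finset.mem_filter.mp he
    have h := hpr v hv e he'.1 he'.2.1
    refine (chiSq_le (hBp e he).1.le (hBr e he).1 ((hq1 e he'.1 _).2.trans (by linarith))
      h.1).trans ?_
    rw [mul_div_assoc]
    exact mul_le_mul_of_nonneg_left h.2.2 (by positivity)
  · have : 0 < p₀ := by rw [hp₀]; positivity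
    positivity


/-! ### Concentration of the community sizes -/

section Labels

variable {K n : ℕ} {α : Fin K → ℝ}

theorem labelMass_nonneg (hα : ∀ k, 0 < α k) (z : Fin n → Fin K) : 0 ≤ labelMass α z :=
  Finset.prod_nonneg fun v _ => (hα (z v)).le

theorem sum_labelMass (hα_sum : ∑ k, α k = 1) : ∑ z : Fin n → Fin K, labelMass α z = 1 := by
  have h := Finset.prod_univ_sum (fun _ : Fin n => (Finset.univ : Finset (Fin K))) (fun _ k => α k)
  rw [Fintype.piFinset_univ] at h
  unfold labelMass
  rw [← h]
  simp [hα_sum]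

/-- The labels of distinct vertices are uncorrelated. -/
theorem sum_labelMass_mul_eq_zero {g : Fin K → ℝ} (hg : ∑ k, α k * g k = 0) {u v : Fin n}
    (huv : u ≠ v) : ∑ z : Fin n → Fin K, labelMass α z * (g (z u) * g (z v)) = 0 := by
  have h := Finset.prod_univ_sum (fun _ : Fin n => (Finset.univ : Finset (Fin K)))
    (fun x k => α k * ((if x = u then g k else 1) * (if x = v then g k else 1)))
  rw [Fintype.piFinset_univ] at h
  have h1 : ∀ z : Fin n → Fin K, labelMass α z * (g (z u) * g (z v))
      = ∏ x, α (z x) * ((if x = u then g (z x) else 1) * (if x = v then g (z x) else 1)) := by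
    intro z
    rw [Finset.prod_mul_distrib, Finset.prod_mul_distrib, Fintype.prod_ite_eq',
      Fintype.prod_ite_eq', labelMass]
  rw [Finset.sum_congr rfl fun z _ => h1 z, ← h]
  refine Finset.prod_eq_zero (Finset.mem_univ u) ?_
  simpa [huv] using hg

theorem sum_labelMass_counts_sq_le (hα : ∀ k, 0 < α k) (hα_sum : ∑ k, α k = 1) (l : Fin K) :
    ∑ z : Fin n → Fin K, labelMass α z * ((counts z Finset.univ l : ℝ) - α l * n) ^ 2 ≤ n := by
  have hα1 : α l ≤ 1 := by
    rw [← hα_sum]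
    exact Finset.single_le_sum (fun k _ => (hα k).le) (Finset.mem_univ l)
  set g : Fin K → ℝ := fun k => (if k = l then 1 else 0) - α l with hg
  have hg0 : ∑ k, α k * g k = 0 := by
    simp [hg, mul_sub, Finset.sum_sub_distrib, ← Finset.sum_mul, hα_sum]
  have hg1 : ∀ k, g k * g k ≤ 1 := fun k => by
    have := (hα l).le
    simp only [hg]
    split_ifs <;> nlinarith
  have h1 : ∀ z : Fin n → Fin K, ((counts z Finset.univ l : ℝ) - α l * n) ^ 2
      = ∑ u, ∑ v, g (z u) * g (z v) := by
    intro z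
    have : (counts z Finset.univ l : ℝ) - α l * n = ∑ v, g (z v) := by
      simp [hg, counts, Finset.sum_sub_distrib, mul_comm]
    rw [this, sq, Finset.sum_mul_sum]
  simp only [h1, Finset.mul_sum]
  rw [Finset.sum_comm]
  calc ∑ u, ∑ z : Fin n → Fin K, ∑ v, labelMass α z * (g (z u) * g (z v))
      = ∑ u, ∑ v, ∑ z : Fin n → Fin K, labelMass α z * (g (z u) * g (z v)) :=
        Finset.sum_congr rfl fun u _ => Finset.sum_comm
    _ = ∑ u : Fin n, ∑ z : Fin n → Fin K, labelMass α z * (g (z u) * g (z u)) :=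
        Finset.sum_congr rfl fun u _ => Finset.sum_eq_single_of_mem u (Finset.mem_univ u)
          fun v _ hvu => sum_labelMass_mul_eq_zero hg0 hvu.symm
    _ ≤ ∑ u : Fin n, ∑ z : Fin n → Fin K, labelMass α z * 1 :=
        Finset.sum_le_sum fun u _ => Finset.sum_le_sum fun z _ =>
          mul_le_mul_of_nonneg_left (hg1 _) (labelMass_nonneg hα z)
    _ = n := by simp [sum_labelMass hα_sum]

/-- The labels `z` are `τ`-balanced if every community size is within a factor `1 ± τ` of its
mean. -/
def Balanced (α : Fin K → ℝ) (τ : ℝ) (z : Fin n → Fin K) : Prop :=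
  ∀ l, |(counts z Finset.univ l : ℝ) - α l * n| ≤ τ * (α l * n)

open Classical in
theorem prob_not_balanced_le (hα : ∀ k, 0 < α k) (hα_sum : ∑ k, α k = 1) {τ : ℝ} (hτ : 0 < τ)
    (hn : 0 < n) :
    ∑ z : Fin n → Fin K, labelMass α z * (if Balanced α τ z then 0 else 1)
      ≤ (∑ l, 1 / (τ * α l) ^ 2) / n := by
  have hn' : (0 : ℝ) < n := by exact_mod_cast hn
  have hpt : ∀ z : Fin n → Fin K, (if Balanced α τ z then (0 : ℝ) else 1)
      ≤ ∑ l, ((counts z Finset.univ l : ℝ) - α l * n) ^ 2 * (1 / (τ * (α l * n)) ^ 2) := by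
    intro z
    split_ifs with h
    · exact Finset.sum_nonneg fun l _ => by positivity
    · unfold Balanced at h
      push Not at h
      obtain ⟨l, hl⟩ := h
      have hpos : 0 < τ * (α l * n) := mul_pos hτ (mul_pos (hα l) hn')
      refine le_trans ?_ (Finset.single_le_sum (fun l _ => by positivity) (Finset.mem_univ l))
      rw [mul_one_div, one_le_div (by positivity), sq_le_sq, abs_of_pos hpos]
      exact hl.le
  calc _ ≤ ∑ z : Fin n → Fin K, labelMass α z *
        ∑ l, ((counts z Finset.univ l : ℝ) - α l * n) ^ 2 * (1 / (τ * (α l * n)) ^ 2) :=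
        Finset.sum_le_sum fun z _ => mul_le_mul_of_nonneg_left (hpt z) (labelMass_nonneg hα z)
    _ = ∑ l, (∑ z : Fin n → Fin K, labelMass α z * ((counts z Finset.univ l : ℝ) - α l * n) ^ 2)
        * (1 / (τ * (α l * n)) ^ 2) := by
        simp only [Finset.mul_sum, Finset.sum_mul]
        rw [Finset.sum_comm]
        exact Finset.sum_congr rfl fun l _ => Finset.sum_congr rfl fun z _ => by ring
    _ ≤ ∑ l, (n : ℝ) * (1 / (τ * (α l * n)) ^ 2) :=
        Finset.sum_le_sum fun l _ => mul_le_mul_of_nonneg_right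
          (sum_labelMass_counts_sq_le hα hα_sum l) (by positivity)
    _ = _ := by
        rw [Finset.sum_div]
        refine Finset.sum_congr rfl fun l _ => ?_
        have := (hα l).ne'
        field_simp

end Labels

/-! ### From confusable vertices to the failure of every estimator -/

section Bayes

variable {K n : ℕ}

theorem mismatch_nonneg (z z' : Fin n → Fin K) : 0 ≤ mismatch z z' :=
  mul_nonneg (by positivity) (Real.iInf_nonneg fun π => Nat.cast_nonneg _)

theorem exists_perm_of_mismatch_eq_zero (hn : 0 < n) {z z' : Fin n → Fin K}
    (h : mismatch z z' = 0) : ∃ π : Equiv.Perm (Fin K), π ∘ z = z' := by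
  obtain ⟨π, hπ⟩ := exists_eq_ciInf_of_finite
    (f := fun π : Equiv.Perm (Fin K) => (hammingDist (π ∘ z) z' : ℝ))
  have hn' : (n : ℝ) ≠ 0 := by exact_mod_cast hn.ne'
  rw [mismatch, ← hπ] at h
  have h0 := (mul_eq_zero.mp h).resolve_left (by simpa using hn')
  exact ⟨π, hammingDist_eq_zero.mp (by exact_mod_cast h0)⟩

theorem sum_pmf_toReal {Ω : Type*} [Fintype Ω] (μ : PMF Ω) : ∑ x, (μ x).toReal = 1 := by
  rw [← ENNReal.toReal_sum fun x _ => μ.apply_ne_top x, ← tsum_fintype (L := .unconditional _),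
    μ.tsum_coe, ENNReal.toReal_one]

theorem mismatchProb_pos_eq (α : Fin K → ℝ) (hα_sum : ∑ k, α k = 1) (M : Finset ℕ)
    (q : ℕ → (Fin K → ℕ) → ℝ) (A : Algorithm K) (n : ℕ) :
    mismatchProb α M q A n (fun η => 0 < η) = 1 - mismatchProb α M q A n (fun η => η = 0) := by
  rw [eq_sub_iff_add_eq, ← expectation_one α hα_sum M q n, mismatchProb, mismatchProb, expectation,
    expectation, expectation, ← Finset.sum_add_distrib]
  refine Finset.sum_congr rfl fun z _ => ?_
  rw [← Finset.sum_add_distrib]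
  refine Finset.sum_congr rfl fun H _ => ?_
  rw [← mul_add, ← Finset.sum_add_distrib, ← sum_pmf_toReal (A n H)]
  congr 1
  refine Finset.sum_congr rfl fun z' _ => ?_
  rcases (mismatch_nonneg z z').eq_or_lt with h | h
  · simp [← h]
  · simp [h, h.ne']

/-- Moving one vertex to another community changes the prior probability by a bounded factor. -/
theorem mul_labelMass_le_update {α : Fin K → ℝ} (hα : ∀ k, 0 < α k) (hα_sum : ∑ k, α k = 1)
    (z : Fin n → Fin K) (v : Fin n) (k : Fin K) :
    α k * labelMass α z ≤ labelMass α (Function.update z v k) := by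
  have hα1 : α (z v) ≤ 1 := by
    rw [← hα_sum]
    exact Finset.single_le_sum (fun k _ => (hα k).le) (Finset.mem_univ (z v))
  rw [labelMass, labelMass, ← Finset.mul_prod_erase _ _ (Finset.mem_univ v),
    ← Finset.mul_prod_erase (a := v) _ (fun x => α (Function.update z v k x)) (Finset.mem_univ v)]
  have h : ∏ x ∈ Finset.univ.erase v, α (Function.update z v k x)
      = ∏ x ∈ Finset.univ.erase v, α (z x) :=
    Finset.prod_congr rfl fun x hx => by rw [Function.update_of_ne (Finset.ne_of_mem_erase hx)]
  rw [h, Function.update_self]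
  have h0 : 0 ≤ ∏ x ∈ Finset.univ.erase v, α (z x) := Finset.prod_nonneg fun x _ => (hα _).le
  exact mul_le_mul_of_nonneg_left (mul_le_of_le_one_left h0 hα1) (hα k).le

open Classical in
/-- If, with high probability, moving any one of at least `N` vertices from community `j` to
community `k` costs at most a factor `ρ` of likelihood, then the posterior probability of the true
labels is of order `1 / (N ρ)`, so no estimator finds them with a larger probability. The factor
`K!` accounts for the relabellings. -/
theorem mismatchProb_eq_zero_le {α : Fin K → ℝ} (hα : ∀ k, 0 < α k) (hα_sum : ∑ k, α k = 1)
    (M : Finset ℕ) (q : ℕ → (Fin K → ℕ) → ℝ) (A : Algorithm K) (hn : 0 < n)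
    (hq : ∀ m ∈ M, ∀ w ∈ weakComps K m, 0 ≤ q m w ∧ q m w ≤ 1) {j k : Fin K} (hjk : j ≠ k)
    (Good : (Fin n → Fin K) → Prop) {N ρ b : ℝ} (hN : 0 < N) (hρ : 0 < ρ) (hb : 0 ≤ b)
    (hgood : ∀ z, Good z → bernoulliExp (possibleEdges M n) (fun e => q e.card (counts z e))
      (fun H => if (((Finset.univ.filter fun v => z v = j).filter fun v =>
        ρ * edgeMass M q z H ≤ edgeMass M q (Function.update z v k) H).card : ℝ) < N
        then 1 else 0) ≤ b) :
    mismatchProb α M q A n (fun η => η = 0)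
      ≤ ∑ z : Fin n → Fin K, labelMass α z * (if Good z then 0 else 1) + b
        + K.factorial / (N * (ρ * α k)) := by
  set E := possibleEdges M n with hE
  set C : (Fin n → Fin K) → Hypergraph n → Finset (Fin n) := fun z H =>
    (Finset.univ.filter fun v => z v = j).filter fun v =>
      ρ * edgeMass M q z H ≤ edgeMass M q (Function.update z v k) H with hC
  set W : (Fin n → Fin K) → Hypergraph n → ℝ := fun z H => labelMass α z * edgeMass M q z H with hW
  have hem0 : ∀ (z : Fin n → Fin K) (H : Hypergraph n), 0 ≤ edgeMass M q z H := fun z H => by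
    rw [edgeMass_eq_bernoulliMass]
    refine bernoulliMass_nonneg (fun e he => hq _ ?_ _ (counts_mem_weakComps z e)) H
    simpa [possibleEdges] using he
  have hW0 : ∀ z H, 0 ≤ W z H := fun z H => mul_nonneg (labelMass_nonneg hα z) (hem0 z H)
  set T : Hypergraph n → ℝ := fun H => ∑ z, W z H with hT
  have hT0 : ∀ H, 0 ≤ T H := fun H => Finset.sum_nonneg fun z _ => hW0 z H
  have hαk := hα k
  -- The labellings obtained by moving one confusable vertex compete with `z`.
  have hpost : ∀ z H, N ≤ (C z H).card → W z H ≤ T H / (N * (ρ * α k)) := by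
    intro z H hcard
    rw [le_div_iff₀ (by positivity)]
    have hinj : Set.InjOn (fun v => Function.update z v k) (C z H : Set (Fin n)) := by
      intro u hu v hv huv
      by_contra hne
      have hzu : z u = j := by
        have := Finset.mem_coe.mp hu
        simp only [hC, Finset.mem_filter] at this
        exact this.1.2
      have := congrFun huv u
      simp only [Function.update_self, Function.update_of_ne hne, hzu] at this
      exact hjk this.symm
    calc W z H * (N * (ρ * α k)) = N * (ρ * α k * W z H) := by ring
      _ ≤ (C z H).card * (ρ * α k * W z H) := by
          have := hW0 z H
          gcongr
      _ = ∑ v ∈ C z H, ρ * α k * W z H := by rw [Finset.sum_const, nsmul_eq_mul]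
      _ ≤ ∑ v ∈ C z H, W (Function.update z v k) H := by
          refine Finset.sum_le_sum fun v hv => ?_
          have h1 := mul_labelMass_le_update hα hα_sum z v k
          have h2 := (Finset.mem_filter.mp hv).2
          calc ρ * α k * W z H = (α k * labelMass α z) * (ρ * edgeMass M q z H) := by
                simp only [hW]; ring
            _ ≤ _ := mul_le_mul h1 h2 (mul_nonneg hρ.le (hem0 z H)) (labelMass_nonneg hα _)
      _ = ∑ z' ∈ (C z H).image (fun v => Function.update z v k), W z' H :=
          (Finset.sum_image (f := fun z' => W z' H) hinj).symm
      _ ≤ T H := Finset.sum_le_sum_of_subset_of_nonneg (Finset.subset_univ _)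
          fun z' _ _ => hW0 z' H
  set s : (Fin n → Fin K) → Hypergraph n → ℝ := fun z H =>
    ∑ z' : Fin n → Fin K, if mismatch z z' = 0 then (A n H z').toReal else 0 with hs
  set g : (Fin n → Fin K) → Hypergraph n → ℝ := fun z H =>
    ∑ π : Equiv.Perm (Fin K), (A n H (π ∘ z)).toReal with hg
  have hg0 : ∀ z H, 0 ≤ g z H := fun z H => Finset.sum_nonneg fun π _ => ENNReal.toReal_nonneg
  have hs1 : ∀ z H, s z H ≤ 1 := fun z H => by
    rw [← sum_pmf_toReal (A n H)]
    refine Finset.sum_le_sum fun z' _ => ?_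
    split_ifs
    · exact le_rfl
    · exact ENNReal.toReal_nonneg
  have hsg : ∀ z H, s z H ≤ g z H := fun z H => by
    have h1 : g z H = ∑ z' : Fin n → Fin K, ∑ π : Equiv.Perm (Fin K),
        if π ∘ z = z' then (A n H z').toReal else 0 := by
      rw [Finset.sum_comm]
      exact Finset.sum_congr rfl fun π _ => by simp
    rw [h1]
    refine Finset.sum_le_sum fun z' _ => ?_
    have hnn : ∀ π ∈ (Finset.univ : Finset (Equiv.Perm (Fin K))),
        0 ≤ if π ∘ z = z' then (A n H z').toReal else 0 := fun π _ => by
      split_ifs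
      · exact ENNReal.toReal_nonneg
      · exact le_rfl
    split_ifs with h
    · obtain ⟨π, hπ⟩ := exists_perm_of_mismatch_eq_zero hn h
      refine le_trans ?_ (Finset.single_le_sum hnn (Finset.mem_univ π))
      rw [if_pos hπ]
    · exact Finset.sum_nonneg hnn
  have hsumg : ∀ H, ∑ z, g z H = K.factorial := fun H => by
    rw [Finset.sum_comm]
    have : ∀ π : Equiv.Perm (Fin K), ∑ z : Fin n → Fin K, (A n H (π ∘ z)).toReal = 1 := fun π => by
      rw [← sum_pmf_toReal (A n H)]
      exact Equiv.sum_comp (Equiv.arrowCongr (Equiv.refl (Fin n)) π)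
        (fun z' => (A n H z').toReal)
    rw [Finset.sum_congr rfl fun π _ => this π]
    simp [Fintype.card_perm]
  have hE1 : ∀ z : Fin n → Fin K, ∑ H ∈ E.powerset, edgeMass M q z H = 1 := fun z => by
    have := bernoulliExp_one (E := E) (p := fun e => q e.card (counts z e))
    simpa [bernoulliExp, edgeMass_eq_bernoulliMass] using this
  have hpt : ∀ z H, W z H * s z H ≤ W z H * (if Good z then 0 else 1)
      + W z H * (if Good z then (if ((C z H).card : ℝ) < N then 1 else 0) else 0)
      + T H / (N * (ρ * α k)) * g z H := by
    intro z H
    have h1 : 0 ≤ T H / (N * (ρ * α k)) * g z H :=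
      mul_nonneg (div_nonneg (hT0 H) (by positivity)) (hg0 z H)
    have h2 : W z H * s z H ≤ W z H := mul_le_of_le_one_right (hW0 z H) (hs1 z H)
    split_ifs with h3 h4
    · linarith
    · have := mul_le_mul (hpost z H (not_lt.mp h4)) (hsg z H)
        (Finset.sum_nonneg fun z' _ => by split_ifs; exacts [ENNReal.toReal_nonneg, le_rfl])
        (div_nonneg (hT0 H) (by positivity))
      linarith
    · linarith
  rw [mismatchProb, expectation]
  calc _ ≤ ∑ z, ∑ H ∈ E.powerset, (W z H * (if Good z then 0 else 1)
      + W z H * (if Good z then (if ((C z H).card : ℝ) < N then 1 else 0) else 0)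
      + T H / (N * (ρ * α k)) * g z H) :=
        Finset.sum_le_sum fun z _ => Finset.sum_le_sum fun H _ => hpt z H
    _ = ∑ z, labelMass α z * (if Good z then 0 else 1)
        + ∑ z, labelMass α z * (if Good z then bernoulliExp E (fun e => q e.card (counts z e))
            (fun H => if ((C z H).card : ℝ) < N then 1 else 0) else 0)
        + ∑ H ∈ E.powerset, T H / (N * (ρ * α k)) * K.factorial := by
        simp only [Finset.sum_add_distrib]
        congr 1
        · congr 1
          · refine Finset.sum_congr rfl fun z _ => ?_
            rw [← Finset.sum_mul, ← Finset.mul_sum, hE1, mul_one]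
          · refine Finset.sum_congr rfl fun z _ => ?_
            split_ifs with h
            · rw [bernoulliExp, Finset.mul_sum]
              refine Finset.sum_congr rfl fun H _ => ?_
              rw [← edgeMass_eq_bernoulliMass, mul_assoc]
            · simp
        · rw [Finset.sum_comm]
          exact Finset.sum_congr rfl fun H _ => by rw [← Finset.mul_sum, hsumg]
    _ ≤ _ := by
        gcongr
        · calc _ ≤ ∑ z : Fin n → Fin K, labelMass α z * b := by
                refine Finset.sum_le_sum fun z _ =>
                  mul_le_mul_of_nonneg_left ?_ (labelMass_nonneg hα z)
                split_ifs with h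
                · exact hgood z h
                · exact hb
            _ = b := by rw [← Finset.sum_mul, sum_labelMass hα_sum, one_mul]
        · have hT1 : ∑ H ∈ E.powerset, T H = 1 := by
            rw [Finset.sum_comm]
            rw [Finset.sum_congr rfl fun z _ => by rw [← Finset.mul_sum, hE1, mul_one]]
            exact sum_labelMass hα_sum
          rw [← Finset.sum_mul, ← Finset.sum_div, hT1, one_div_mul_eq_div]

end Bayes

/-! ### The divergence and the numbers of hyperedges of a given type -/

section Divergence

variable {K : ℕ}

/-- The function of `t` whose maximum is the generalized Chernoff–Hellinger divergence. -/
noncomputable def gchFun (α : Fin K → ℝ) (M : Finset ℕ) (P : ℕ → ℕ → (Fin K → ℕ) → ℝ) (n : ℕ)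
    (j k : Fin K) (t : ℝ) : ℝ :=
  ∑ m ∈ M, ∑ w ∈ weakComps K (m - 1), nbar α n w / ((n - 1).choose (m - 1) : ℝ) *
    meanGap t (P n m (bump j w)) (P n m (bump k w))

theorem nbar_nonneg (α : Fin K → ℝ) (n : ℕ) (w : Fin K → ℕ) : 0 ≤ nbar α n w :=
  Finset.prod_nonneg fun _ _ => Nat.cast_nonneg _

variable {α : Fin K → ℝ} {M : Finset ℕ} {P : ℕ → ℕ → (Fin K → ℕ) → ℝ} {n : ℕ} {j k : Fin K}

theorem gchFun_le_gchPair (hM : ∀ m ∈ M, 2 ≤ m)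
    (hP : ∀ m ∈ M, ∀ w ∈ weakComps K m, 0 ≤ P n m w) {t : ℝ} (ht : t ∈ Set.Icc (0 : ℝ) 1) :
    gchFun α M P n j k t ≤ gchPair α M P n j k := by
  have hbdd : BddAbove (Set.range fun t : Set.Icc (0 : ℝ) 1 => gchFun α M P n j k t) := by
    refine ⟨∑ m ∈ M, ∑ w ∈ weakComps K (m - 1), nbar α n w / ((n - 1).choose (m - 1) : ℝ) *
      (P n m (bump j w) + P n m (bump k w)), ?_⟩
    rintro _ ⟨t, rfl⟩
    refine Finset.sum_le_sum fun m hm => Finset.sum_le_sum fun w hw => ?_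
    refine mul_le_mul_of_nonneg_left ?_ (div_nonneg (nbar_nonneg α n w) (Nat.cast_nonneg _))
    have hm1 : 1 ≤ m := one_le_two.trans (hM m hm)
    have h1 := hP m hm _ (bump_mem_weakComps hm1 j hw)
    have h2 := hP m hm _ (bump_mem_weakComps hm1 k hw)
    have h3 : 0 ≤ P n m (bump j w) ^ (t : ℝ) * P n m (bump k w) ^ (1 - (t : ℝ)) := by positivity
    have h4 := t.2.1
    have h5 := t.2.2
    rw [meanGap]
    nlinarith
  exact le_ciSup hbdd ⟨t, ht⟩

theorem exists_gchPair_le (hK : 2 ≤ K) {x : ℝ} (h : gch α M P n ≤ x) :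
    ∃ j k : Fin K, j ≠ k ∧ gchPair α M P n j k ≤ x := by
  have : Nonempty {p : Fin K × Fin K // p.1 ≠ p.2} :=
    ⟨⟨(⟨0, by omega⟩, ⟨1, by omega⟩), by simp⟩⟩
  obtain ⟨p, hp⟩ := exists_eq_ciInf_of_finite
    (f := fun p : {p : Fin K × Fin K // p.1 ≠ p.2} => gchPair α M P n p.1.1 p.1.2)
  exact ⟨p.1.1, p.1.2, p.2, hp.le.trans h⟩

/-- A bounded divergence forces the parameters of each type to be close, even when they are
large: this is the value at `t = 1/2`. -/
theorem sq_sqrt_sub_sqrt_le (hM : ∀ m ∈ M, 2 ≤ m)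
    (hP : ∀ m ∈ M, ∀ w ∈ weakComps K m, 0 ≤ P n m w) (hD : gchPair α M P n j k ≤ 1)
    {m : ℕ} (hm : m ∈ M) {w : Fin K → ℕ} (hw : w ∈ weakComps K (m - 1)) {x : ℝ} (hx : 0 < x)
    (hlow : x ≤ nbar α n w / ((n - 1).choose (m - 1) : ℝ)) :
    (√(P n m (bump j w)) - √(P n m (bump k w))) ^ 2 ≤ 2 / x := by
  have hb : ∀ m ∈ M, ∀ i : Fin K, ∀ w ∈ weakComps K (m - 1), 0 ≤ P n m (bump i w) :=
    fun m hm i w hw => hP m hm _ (bump_mem_weakComps (one_le_two.trans (hM m hm)) i hw)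
  have ht : (1 / 2 : ℝ) ∈ Set.Icc (0 : ℝ) 1 := by constructor <;> norm_num
  have h0 : ∀ m ∈ M, ∀ w ∈ weakComps K (m - 1), 0 ≤ nbar α n w / ((n - 1).choose (m - 1) : ℝ) *
      meanGap (1 / 2) (P n m (bump j w)) (P n m (bump k w)) := fun m hm w hw =>
    mul_nonneg (div_nonneg (nbar_nonneg α n w) (Nat.cast_nonneg _))
      (meanGap_nonneg ht (hb m hm j w hw) (hb m hm k w hw))
  have h1 : nbar α n w / ((n - 1).choose (m - 1) : ℝ) *
      meanGap (1 / 2) (P n m (bump j w)) (P n m (bump k w)) ≤ 1 := by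
    refine le_trans ?_ ((gchFun_le_gchPair hM hP ht).trans hD)
    refine le_trans (Finset.single_le_sum (f := fun w => nbar α n w /
      ((n - 1).choose (m - 1) : ℝ) * meanGap (1 / 2) (P n m (bump j w)) (P n m (bump k w)))
      (h0 m hm) hw) ?_
    exact Finset.single_le_sum (f := fun m => ∑ w ∈ weakComps K (m - 1), nbar α n w /
      ((n - 1).choose (m - 1) : ℝ) * meanGap (1 / 2) (P n m (bump j w)) (P n m (bump k w)))
      (fun m hm => Finset.sum_nonneg (h0 m hm)) hm
  rw [meanGap_half (hb m hm j w hw) (hb m hm k w hw)] at h1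
  rw [le_div_iff₀ hx]
  nlinarith [sq_nonneg (√(P n m (bump j w)) - √(P n m (bump k w)))]

theorem le_mul_of_sq_sqrt_sub_le {x y c C : ℝ} (hc : 0 < c) (hx : 0 ≤ x) (hy : c ≤ y)
    (h : (√x - √y) ^ 2 ≤ C) : x ≤ (1 + √(C / c)) ^ 2 * y := by
  have hy0 : 0 < y := hc.trans_le hy
  have hC : 0 ≤ C := (sq_nonneg _).trans h
  have h1 : √x - √y ≤ √C := Real.le_sqrt_of_sq_le h
  have h2 : √C ≤ √(C / c) * √y := by
    rw [← Real.sqrt_mul (by positivity)]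
    refine Real.sqrt_le_sqrt ?_
    rw [div_mul_eq_mul_div, le_div_iff₀ hc]
    gcongr
  have h3 : √x ≤ (1 + √(C / c)) * √y := by linarith
  calc x = √x ^ 2 := (Real.sq_sqrt hx).symm
    _ ≤ ((1 + √(C / c)) * √y) ^ 2 := by gcongr
    _ = _ := by rw [mul_pow, Real.sq_sqrt hy0.le]

end Divergence

section Asymptotics

variable {K : ℕ} {α : Fin K → ℝ}

theorem pow_le_factorial_mul_choose_floor {a τ : ℝ} (ha : 0 < a) (hτ : 0 < τ) (hτ1 : τ < 1)
    (w : ℕ) : ∀ᶠ n : ℕ in atTop,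
      ((1 - τ) * (a * n)) ^ w ≤ (w.factorial : ℝ) * ((⌊a * n⌋₊.choose w : ℕ) : ℝ) := by
  have h : Tendsto (fun n : ℕ => τ * a * (n : ℝ)) atTop atTop :=
    tendsto_natCast_atTop_atTop.const_mul_atTop (by positivity)
  filter_upwards [h.eventually_ge_atTop (w : ℝ)] with n hn
  have h1 := Nat.pow_le_choose (α := ℝ) w ⌊a * n⌋₊
  have h2 := Nat.lt_floor_add_one (a * (n : ℝ))
  have h3 : (1 - τ) * (a * n) ≤ ((⌊a * (n : ℝ)⌋₊ + 1 - w : ℕ) : ℝ) := by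
    have : ((⌊a * (n : ℝ)⌋₊ + 1 : ℕ) : ℝ) ≤ ((⌊a * (n : ℝ)⌋₊ + 1 - w : ℕ) : ℝ) + (w : ℝ) := by
      exact_mod_cast (by omega : ⌊a * (n : ℝ)⌋₊ + 1 ≤ (⌊a * (n : ℝ)⌋₊ + 1 - w) + w)
    push_cast at this ⊢
    linarith
  have h4 : 0 ≤ (1 - τ) * (a * n) := by
    have : 0 ≤ 1 - τ := by linarith
    positivity
  rw [div_le_iff₀' (by exact_mod_cast w.factorial_pos)] at h1
  exact (pow_le_pow_left₀ h4 h3 w).trans h1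

/-- The mean number of hyperedges of a given type through a vertex is of the order of the number
of all of them. -/
theorem eventually_le_nbar_div (hα : ∀ k, 0 < α k) (w : Fin K → ℕ) :
    ∀ᶠ n : ℕ in atTop, (∏ l, (α l / 2) ^ w l / (w l).factorial : ℝ)
      ≤ nbar α n w / ((n - 1).choose (∑ l, w l) : ℝ) := by
  have h : ∀ᶠ n : ℕ in atTop, ∀ l, ((1 - 1 / 2) * (α l * n)) ^ w l
      ≤ ((w l).factorial : ℝ) * ((⌊α l * n⌋₊.choose (w l) : ℕ) : ℝ) :=
    eventually_all.mpr fun l =>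
      pow_le_factorial_mul_choose_floor (hα l) (by norm_num) (by norm_num) (w l)
  filter_upwards [h, eventually_ge_atTop (∑ l, w l + 1)] with n hn hnw
  have hpos : (0 : ℝ) < ((n - 1).choose (∑ l, w l) : ℝ) := by
    exact_mod_cast Nat.choose_pos (by omega)
  rw [le_div_iff₀ hpos, nbar]
  have h1 : ((n - 1).choose (∑ l, w l) : ℝ) ≤ ∏ l, (n : ℝ) ^ w l := by
    rw [Finset.prod_pow_eq_pow_sum]
    have : (n - 1).choose (∑ l, w l) ≤ n ^ (∑ l, w l) :=
      (Nat.choose_le_pow _ _).trans (Nat.pow_le_pow_left (Nat.sub_le n 1) _)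
    exact_mod_cast this
  have h0 : ∀ l, 0 ≤ (α l / 2) ^ w l / ((w l).factorial : ℝ) := fun l => by
    have := (hα l).le
    positivity
  calc _ ≤ (∏ l, (α l / 2) ^ w l / (w l).factorial : ℝ) * ∏ l, (n : ℝ) ^ w l :=
        mul_le_mul_of_nonneg_left h1 (Finset.prod_nonneg fun l _ => h0 l)
    _ = ∏ l, (α l / 2) ^ w l / (w l).factorial * (n : ℝ) ^ w l := Finset.prod_mul_distrib.symm
    _ ≤ _ := by
        refine Finset.prod_le_prod (fun l _ => mul_nonneg (h0 l) (by positivity)) fun l _ => ?_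
        have h5 : (0 : ℝ) < (w l).factorial := by exact_mod_cast (w l).factorial_pos
        rw [div_mul_eq_mul_div, div_le_iff₀ h5, ← mul_pow]
        have := hn l
        have e : (1 - 1 / 2) * (α l * (n : ℝ)) = α l / 2 * n := by ring
        rw [e] at this
        linarith

/-- For balanced labels, the number of hyperedges of a given type exceeds its mean by a factor close
to `1` at most. -/
theorem eventually_prod_choose_counts_le (hα : ∀ k, 0 < α k) {τ : ℝ} (hτ : 0 < τ) (hτ1 : τ < 1)
    (w : Fin K → ℕ) : ∀ᶠ n : ℕ in atTop, ∀ z : Fin n → Fin K, Balanced α τ z →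
      ((∏ l, (counts z Finset.univ l).choose (w l) : ℕ) : ℝ)
        ≤ ((1 + τ) / (1 - τ)) ^ (∑ l, w l) * nbar α n w := by
  have h : ∀ᶠ n : ℕ in atTop, ∀ l, ((1 - τ) * (α l * n)) ^ w l
      ≤ ((w l).factorial : ℝ) * ((⌊α l * n⌋₊.choose (w l) : ℕ) : ℝ) :=
    eventually_all.mpr fun l => pow_le_factorial_mul_choose_floor (hα l) hτ hτ1 (w l)
  filter_upwards [h] with n hn z hz
  have hτ2 : 0 < 1 - τ := by linarith
  rw [nbar, ← Finset.prod_pow_eq_pow_sum, ← Finset.prod_mul_distrib]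
  push_cast
  refine Finset.prod_le_prod (fun l _ => Nat.cast_nonneg _) fun l _ => ?_
  have h5 : (0 : ℝ) < (w l).factorial := by exact_mod_cast (w l).factorial_pos
  have h1 : (counts z Finset.univ l : ℝ) ≤ (1 + τ) * (α l * n) := by
    have := (abs_le.mp (hz l)).2
    linarith
  have hαl := (hα l).le
  calc ((counts z Finset.univ l).choose (w l) : ℝ)
      ≤ (counts z Finset.univ l : ℝ) ^ w l / (w l).factorial := Nat.choose_le_pow_div _ _
    _ ≤ ((1 + τ) * (α l * n)) ^ w l / (w l).factorial := by gcongr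
    _ = ((1 + τ) / (1 - τ)) ^ w l * (((1 - τ) * (α l * n)) ^ w l / (w l).factorial) := by
        rw [← mul_div_assoc, ← mul_pow]
        congr 2
        field_simp
    _ ≤ _ := by
        refine mul_le_mul_of_nonneg_left ?_ (by positivity)
        rw [div_le_iff₀ h5]
        linarith [hn l]

end Asymptotics


/-! ### The failure probability -/

/-- An explicit upper bound, for fixed `n`, for the probability of exact recovery. Here `C` bounds
the squared differences of the square roots of the parameters, and `s` is the number of vertices of
community `j` for which the move to community `k` is considered. -/
theorem mismatchProb_eq_zero_le_of_gchFun_le {K n : ℕ} {α : Fin K → ℝ} (hα : ∀ k, 0 < α k)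
    (hα_sum : ∑ k, α k = 1) {M : Finset ℕ} (hM : ∀ m ∈ M, 2 ≤ m)
    {P : ℕ → ℕ → (Fin K → ℕ) → ℝ} (A : Algorithm K) (hn : 2 ≤ n) (hnM : ∀ m ∈ M, m ≤ n)
    {θ τ ε δ κ C R : ℝ} {s : ℕ} {j k : Fin K} (hjk : j ≠ k)
    (hθ : 0 < θ) (hθ4 : θ ≤ 1 / 4) (hτ : 0 < τ) (hδ : 0 < δ) (hκ : 0 < κ)
    (hC : 0 ≤ C) (hR : 1 ≤ R)
    (hP : ∀ m ∈ M, ∀ w ∈ weakComps K m, 0 < P n m w)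
    (hq : ∀ m ∈ M, ∀ w ∈ weakComps K m, edgeProb P n m w ≤ θ)
    (hPC : ∀ m ∈ M, ∀ w ∈ weakComps K (m - 1),
      (√(P n m (bump j w)) - √(P n m (bump k w))) ^ 2 ≤ C)
    (hPjk : ∀ m ∈ M, ∀ w ∈ weakComps K (m - 1), P n m (bump j w) ≤ R * P n m (bump k w))
    (hPkj : ∀ m ∈ M, ∀ w ∈ weakComps K (m - 1), P n m (bump k w) ≤ R * P n m (bump j w))
    (hcount : ∀ z : Fin n → Fin K, Balanced α τ z → ∀ m ∈ M, ∀ w ∈ weakComps K (m - 1),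
      ((∏ l, (counts z Finset.univ l).choose (w l) : ℕ) : ℝ) ≤ (1 + θ) * nbar α n w)
    (hD : ∀ t ∈ Set.Icc (0 : ℝ) 1, gchFun α M P n j k t ≤ 1 - ε)
    (hs : ∀ z : Fin n → Fin K, Balanced α τ z → s ≤ counts z Finset.univ j)
    (hκs : κ * n ≤ s)
    (hconst : (1 + 4 * θ) * ((1 + θ) * (1 - ε) + 2 * θ * (M.card * C)) ≤ 1 - ε / 2)
    (hV : 8 * R * (R + 1) * (M.card * (C * Real.log n)) ≤ (δ * Real.log n) ^ 2 / 2)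
    (hshare : s * (∑ m ∈ M, (m : ℝ)) / (n - 1) * (4 * (R + 1) * C) ≤ δ / 2) :
    mismatchProb α M (edgeProb P n) A n (fun η => η = 0)
      ≤ (∑ l, 1 / (τ * α l) ^ 2) / n
        + (8 / κ * Real.exp (-((ε / 2 - δ) * Real.log n)) + 4 * Real.exp (-(δ / 2 * Real.log n)))
        + K.factorial * (8 / κ) * (∑ l, 1 / α l) * Real.exp (-((ε / 2 - 3 * δ) * Real.log n)) := by
  have hn0 : (0 : ℝ) < n := by exact_mod_cast (by omega : 0 < n)
  set L := Real.log n with hL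
  have hL0 : 0 < L := Real.log_pos (by exact_mod_cast (by omega : 1 < n))
  have hnL : (n : ℝ) = Real.exp L := (Real.exp_log hn0).symm
  have hch : ∀ m ∈ M, (0 : ℝ) < ((n - 1).choose (m - 1) : ℝ) := fun m hm => by
    exact_mod_cast Nat.choose_pos (Nat.sub_le_sub_right (hnM m hm) 1)
  have hscale : ∀ m ∈ M, 0 < L / ((n - 1).choose (m - 1) : ℝ) := fun m hm =>
    div_pos hL0 (hch m hm)
  have hbump : ∀ m ∈ M, ∀ i : Fin K, ∀ w ∈ weakComps K (m - 1), 0 < P n m (bump i w) :=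
    fun m hm i w hw => hP m hm _ (bump_mem_weakComps (one_le_two.trans (hM m hm)) i hw)
  have hq0 : ∀ m ∈ M, ∀ w ∈ weakComps K m, 0 < edgeProb P n m w ∧ edgeProb P n m w ≤ θ :=
    fun m hm w hw => ⟨mul_pos (hP m hm w hw) (hscale m hm), hq m hm w hw⟩
  set X := (1 + θ) * (1 - ε) * L with hX
  set p₀ := Real.exp (-((1 + 4 * θ) * (X + 2 * θ * (M.card * (C * L))))) *
    Real.exp (-(δ * L)) / 2 with hp₀
  set β := Real.exp (-(δ * L) + s * (∑ m ∈ M, (m : ℝ)) / (n - 1) * (4 * (R + 1) * (C * L))) with hβ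
  have hs0 : (0 : ℝ) < s := (mul_pos hκ hn0).trans_le hκs
  have hs0' : 0 < s := by exact_mod_cast hs0
  have hp₀pos : 0 < p₀ := by positivity
  have hβle : β ≤ Real.exp (-(δ / 2 * L)) := by
    rw [hβ, Real.exp_le_exp]
    have := mul_le_mul_of_nonneg_right hshare hL0.le
    nlinarith
  have hsp : κ / 2 * Real.exp ((ε / 2 - δ) * L) ≤ s * p₀ := by
    have h1 : Real.exp (-((1 - ε / 2) * L)) * Real.exp (-(δ * L)) / 2 ≤ p₀ := by
      rw [hp₀]
      have : (1 + 4 * θ) * (X + 2 * θ * (M.card * (C * L))) ≤ (1 - ε / 2) * L := by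
        calc _ = (1 + 4 * θ) * ((1 + θ) * (1 - ε) + 2 * θ * (M.card * C)) * L := by rw [hX]; ring
          _ ≤ _ := mul_le_mul_of_nonneg_right hconst hL0.le
      gcongr
    calc κ / 2 * Real.exp ((ε / 2 - δ) * L)
        = κ * n * (Real.exp (-((1 - ε / 2) * L)) * Real.exp (-(δ * L)) / 2) := by
          have : (ε / 2 - δ) * L = L + (-((1 - ε / 2) * L) + -(δ * L)) := by ring
          rw [this, Real.exp_add, Real.exp_add, ← hnL]
          ring
      _ ≤ s * p₀ := mul_le_mul hκs h1 (by positivity) hs0.le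
  have hexp : 4 / (s * p₀) ≤ 8 / κ * Real.exp (-((ε / 2 - δ) * L)) := by
    rw [Real.exp_neg]
    calc 4 / (s * p₀) ≤ 4 / (κ / 2 * Real.exp ((ε / 2 - δ) * L)) := by gcongr
      _ = _ := by field_simp; norm_num
  have hmain := mismatchProb_eq_zero_le (n := n) hα hα_sum M (edgeProb P n) A (by omega)
    (fun m hm w hw => ⟨(hq0 m hm w hw).1.le, (hq0 m hm w hw).2.trans (by linarith)⟩) hjk
    (Balanced α τ) (N := s * p₀ / 4) (ρ := Real.exp (-(2 * (δ * L))))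
    (b := 4 / (s * p₀) + 4 * β) (by positivity) (Real.exp_pos _) (by positivity) ?_
  · refine hmain.trans (add_le_add (add_le_add ?_ ?_) ?_)
    · exact prob_not_balanced_le hα hα_sum hτ (by omega)
    · linarith
    · have hαk := hα k
      have h1 : 1 / α k ≤ ∑ l, 1 / α l :=
        Finset.single_le_sum (f := fun l => 1 / α l) (fun l _ => (one_div_pos.mpr (hα l)).le)
          (Finset.mem_univ k)
      have h2 : Real.exp (-((ε / 2 - 3 * δ) * L))
          = Real.exp (-((ε / 2 - δ) * L)) * Real.exp (2 * (δ * L)) := by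
        rw [← Real.exp_add]; ring_nf
      calc (K.factorial : ℝ) / (s * p₀ / 4 * (Real.exp (-(2 * (δ * L))) * α k))
          = K.factorial * (4 / (s * p₀)) * (1 / α k) * Real.exp (2 * (δ * L)) := by
            rw [Real.exp_neg]; field_simp
        _ ≤ K.factorial * (8 / κ * Real.exp (-((ε / 2 - δ) * L))) * (∑ l, 1 / α l)
            * Real.exp (2 * (δ * L)) := by gcongr
        _ = _ := by rw [h2]; ring
  · intro z hz
    obtain ⟨S, hSsub, hScard⟩ := Finset.exists_subset_card_eq (hs z hz)
    have hSj : ∀ v ∈ S, z v = j := fun v hv => (Finset.mem_filter.mp (hSsub hv)).2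
    have hS := prob_confusable_card_lt_le M hM hn (edgeProb P n) z j k S hSj (θ := θ) (R := R)
      (D := C * L) (X := X) (t := δ * L) (p₀ := p₀) (β := β) hθ.le hθ4 hR (by positivity)
      (by positivity) hq0 ?_ ?_ ?_ ?_ hV hp₀ (by rw [hScard]) (by omega)
    · rw [hScard] at hS
      refine le_trans (bernoulliExp_mono (fun e he => ?_) fun H _ => ?_) hS
      · have hm : e.card ∈ M := by simpa [possibleEdges] using he
        have := hq0 _ hm _ (counts_mem_weakComps z e)
        exact ⟨this.1.le, this.2.trans (by linarith)⟩
      · have hsub : S.filter (fun v => Real.exp (-(2 * (δ * L))) * edgeMass M (edgeProb P n) z H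
            ≤ edgeMass M (edgeProb P n) (Function.update z v k) H) ⊆
            (Finset.univ.filter fun v => z v = j).filter fun v => Real.exp (-(2 * (δ * L))) *
              edgeMass M (edgeProb P n) z H
              ≤ edgeMass M (edgeProb P n) (Function.update z v k) H :=
          Finset.filter_subset_filter _ hSsub
        have hcard := (Nat.cast_le (α := ℝ)).mpr (Finset.card_le_card hsub)
        split_ifs with h1 h2 h2
        · exact le_rfl
        · exact absurd (hcard.trans_lt h1) h2
        · exact zero_le_one
        · exact le_rfl
    · intro m hm w hw
      have := mul_le_mul_of_nonneg_right (hPjk m hm w hw) (hscale m hm).le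
      simp only [edgeProb]
      linarith
    · intro m hm w hw
      have := mul_le_mul_of_nonneg_right (hPkj m hm w hw) (hscale m hm).le
      simp only [edgeProb]
      linarith
    · intro m hm w hw
      simp only [edgeProb]
      rw [← hL, Real.sqrt_mul (hbump m hm j w hw).le, Real.sqrt_mul (hbump m hm k w hw).le,
        ← sub_mul, mul_pow, Real.sq_sqrt (hscale m hm).le, mul_div_assoc]
      exact mul_le_mul_of_nonneg_right (hPC m hm w hw) (hscale m hm).le
    · intro t ht
      calc _ ≤ ∑ m ∈ M, ∑ w ∈ weakComps K (m - 1), (1 + θ) * nbar α n w *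
            (meanGap t (P n m (bump j w)) (P n m (bump k w))
              * (L / ((n - 1).choose (m - 1) : ℝ))) := by
            refine Finset.sum_le_sum fun m hm => Finset.sum_le_sum fun w hw => ?_
            simp only [edgeProb]
            rw [← hL, meanGap_mul (hbump m hm j w hw).le (hbump m hm k w hw).le (hscale m hm)]
            refine mul_le_mul_of_nonneg_right (hcount z hz m hm w hw) (mul_nonneg ?_ (hscale m hm).le)
            exact meanGap_nonneg ht (hbump m hm j w hw).le (hbump m hm k w hw).le
        _ = (1 + θ) * gchFun α M P n j k t * L := by
            rw [gchFun, Finset.mul_sum, Finset.sum_mul]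
            refine Finset.sum_congr rfl fun m _ => ?_
            rw [Finset.mul_sum, Finset.sum_mul]
            exact Finset.sum_congr rfl fun w _ => by ring
        _ ≤ X := by
            have := hD t ht
            rw [hX]
            gcongr


theorem mismatchProb_eq_zero_nonneg {K n : ℕ} {α : Fin K → ℝ} (hα : ∀ k, 0 < α k) (M : Finset ℕ)
    (q : ℕ → (Fin K → ℕ) → ℝ) (hq : ∀ m ∈ M, ∀ w ∈ weakComps K m, 0 ≤ q m w ∧ q m w ≤ 1)
    (A : Algorithm K) : 0 ≤ mismatchProb α M q A n (fun η => η = 0) := by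
  refine Finset.sum_nonneg fun z _ => Finset.sum_nonneg fun H _ => mul_nonneg (mul_nonneg
    (labelMass_nonneg hα z) ?_) (Finset.sum_nonneg fun z' _ => ?_)
  · rw [edgeMass_eq_bernoulliMass]
    refine bernoulliMass_nonneg (fun e he => hq _ ?_ _ (counts_mem_weakComps z e)) H
    simpa [possibleEdges] using he
  · split_ifs
    · exact ENNReal.toReal_nonneg
    · exact le_rfl

theorem tendsto_exp_neg_mul_log {x : ℝ} (hx : 0 < x) :
    Tendsto (fun n : ℕ => Real.exp (-(x * Real.log n))) atTop (𝓝 0) :=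
  Real.tendsto_exp_neg_atTop_nhds_zero.comp
    ((Real.tendsto_log_atTop.comp tendsto_natCast_atTop_atTop).const_mul_atTop hx)

/-- The constants are chosen in the order `θ` (error of the Poisson approximation and of the edge
counts), `τ` (balance of the labels), `κ` (density of the set of vertices that are moved); the
number `δ = ε / 16` is the exponent that may be lost in each comparison of likelihoods. -/
theorem tendsto_mismatchProb_eq_zero {K : ℕ} (hK : 2 ≤ K) (α : Fin K → ℝ) (hα : ∀ k, 0 < α k)
    (hα_sum : ∑ k, α k = 1) (M : Finset ℕ) (hM : ∀ m ∈ M, 2 ≤ m)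
    (P : ℕ → ℕ → (Fin K → ℕ) → ℝ)
    (hP : ∃ c > 0, ∀ᶠ n in atTop, ∀ m ∈ M, ∀ w ∈ weakComps K m, c ≤ P n m w)
    (hQ : ∀ m ∈ M, ∀ w ∈ weakComps K m, Tendsto (fun n => edgeProb P n m w) atTop (𝓝 0))
    (hD : ∃ ε > 0, ∀ᶠ n in atTop, gch α M P n ≤ 1 - ε) (A : Algorithm K) :
    Tendsto (fun n => mismatchProb α M (edgeProb P n) A n fun η => η = 0) atTop (𝓝 0) := by
  obtain ⟨c, hc, hP⟩ := hP
  obtain ⟨ε, hε, hD⟩ := hD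
  set low : (Fin K → ℕ) → ℝ := fun w => ∏ l, (α l / 2) ^ w l / (w l).factorial with hlow
  have hlow0 : ∀ w, 0 < low w := fun w => Finset.prod_pos fun l _ => by
    have := hα l
    positivity
  set C : ℝ := ∑ m ∈ M, ∑ w ∈ weakComps K (m - 1), 2 / low w with hC
  have hC0 : 0 ≤ C := Finset.sum_nonneg fun m _ => Finset.sum_nonneg fun w _ =>
    (div_pos two_pos (hlow0 w)).le
  have hCle : ∀ m ∈ M, ∀ w ∈ weakComps K (m - 1), 2 / low w ≤ C := fun m hm w hw =>
    (Finset.single_le_sum (f := fun w => 2 / low w)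
      (fun w _ => (div_pos two_pos (hlow0 w)).le) hw).trans
    (Finset.single_le_sum (f := fun m => ∑ w ∈ weakComps K (m - 1), 2 / low w)
      (fun m _ => Finset.sum_nonneg fun w _ => (div_pos two_pos (hlow0 w)).le) hm)
  set R : ℝ := (1 + √(C / c)) ^ 2 with hR
  have hR1 : 1 ≤ R := one_le_pow₀ (by linarith [Real.sqrt_nonneg (C / c)])
  set δ := ε / 16 with hδ
  have hδ0 : 0 < δ := by positivity
  obtain ⟨θ, hconst, hθ⟩ : ∃ θ : ℝ, (1 + 4 * θ) * ((1 + θ) * (1 - ε) + 2 * θ * (M.card * C))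
      < 1 - ε / 2 ∧ θ ∈ Set.Ioc (0 : ℝ) (1 / 4) := by
    have hcont : Continuous fun θ : ℝ =>
        (1 + 4 * θ) * ((1 + θ) * (1 - ε) + 2 * θ * (M.card * C)) := by fun_prop
    have hlim := hcont.tendsto' 0 (1 - ε) (by ring)
    have h1 := (hlim.mono_left nhdsWithin_le_nhds).eventually_lt_const
      (u := 1 - ε / 2) (f := fun θ : ℝ =>
        (1 + 4 * θ) * ((1 + θ) * (1 - ε) + 2 * θ * (M.card * C))) (l := 𝓝[>] (0 : ℝ))
      (by linarith)
    exact (h1.and (Ioc_mem_nhdsGT (by norm_num))).exists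
  obtain ⟨τ, hτM, hτ⟩ : ∃ τ : ℝ, (∀ m ∈ M, ((1 + τ) / (1 - τ)) ^ (m - 1) < 1 + θ) ∧
      τ ∈ Set.Ioc (0 : ℝ) (1 / 2) := by
    have h1 : ∀ m ∈ M, ∀ᶠ τ : ℝ in 𝓝[>] 0, ((1 + τ) / (1 - τ)) ^ (m - 1) < 1 + θ := by
      intro m _
      have hcont : ContinuousAt (fun τ : ℝ => ((1 + τ) / (1 - τ)) ^ (m - 1)) 0 := by
        refine ContinuousAt.pow (ContinuousAt.div (by fun_prop) (by fun_prop) (by norm_num)) _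
      refine (hcont.tendsto.mono_left nhdsWithin_le_nhds).eventually_lt_const ?_
      simpa using hθ.1
    exact (((eventually_all_finset M).mpr h1).and (Ioc_mem_nhdsGT (by norm_num))).exists
  obtain ⟨κ, ⟨hκα, hκshare⟩, hκ⟩ : ∃ κ : ℝ, ((∀ l, κ < α l / 4) ∧
      4 * κ * (∑ m ∈ M, (m : ℝ)) * (4 * (R + 1) * C) < δ / 2) ∧ κ ∈ Set.Ioc (0 : ℝ) 1 := by
    have h1 : ∀ᶠ κ : ℝ in 𝓝[>] 0, ∀ l, κ < α l / 4 := eventually_all.mpr fun l =>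
      nhdsWithin_le_nhds (eventually_lt_nhds (by linarith [hα l]))
    have h2 : ∀ᶠ κ : ℝ in 𝓝[>] 0, 4 * κ * (∑ m ∈ M, (m : ℝ)) * (4 * (R + 1) * C) < δ / 2 := by
      have hcont : Continuous fun κ : ℝ => 4 * κ * (∑ m ∈ M, (m : ℝ)) * (4 * (R + 1) * C) := by
        fun_prop
      exact ((hcont.tendsto' 0 0 (by ring)).mono_left nhdsWithin_le_nhds).eventually_lt_const
        (by positivity)
    exact ((h1.and h2).and (Ioc_mem_nhdsGT one_pos)).exists
  have hlogtop : Tendsto (fun n : ℕ => Real.log n) atTop atTop :=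
    Real.tendsto_log_atTop.comp tendsto_natCast_atTop_atTop
  have hqθ : ∀ᶠ n in atTop, ∀ m ∈ M, ∀ w ∈ weakComps K m, edgeProb P n m w < θ :=
    (eventually_all_finset M).mpr fun m hm => (eventually_all_finset _).mpr fun w hw =>
      (hQ m hm w hw).eventually_lt_const hθ.1
  have hnbar : ∀ᶠ n : ℕ in atTop, ∀ m ∈ M, ∀ w ∈ weakComps K (m - 1),
      low w ≤ nbar α n w / ((n - 1).choose (m - 1) : ℝ) :=
    (eventually_all_finset M).mpr fun m hm => (eventually_all_finset _).mpr fun w hw => by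
      have hw' : ∑ l, w l = m - 1 := (Finset.mem_piAntidiag.mp hw).1
      have := eventually_le_nbar_div hα w
      rwa [hw'] at this
  have hcount : ∀ᶠ n : ℕ in atTop, ∀ m ∈ M, ∀ w ∈ weakComps K (m - 1), ∀ z : Fin n → Fin K,
      Balanced α τ z → ((∏ l, (counts z Finset.univ l).choose (w l) : ℕ) : ℝ)
        ≤ (1 + θ) * nbar α n w :=
    (eventually_all_finset M).mpr fun m hm => (eventually_all_finset _).mpr fun w hw => by
      have hw' : ∑ l, w l = m - 1 := (Finset.mem_piAntidiag.mp hw).1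
      filter_upwards [eventually_prod_choose_counts_le hα hτ.1 (by linarith [hτ.2]) w] with n hn z hz
      refine (hn z hz).trans (mul_le_mul_of_nonneg_right ?_ (nbar_nonneg α n w))
      rw [hw']
      exact (hτM m hm).le
  have hκn : ∀ᶠ n : ℕ in atTop, 1 ≤ κ * n :=
    (tendsto_natCast_atTop_atTop.const_mul_atTop hκ.1).eventually_ge_atTop 1
  have hlog : ∀ᶠ n : ℕ in atTop, 16 * R * (R + 1) * (M.card * C) / δ ^ 2 ≤ Real.log n :=
    hlogtop.eventually_ge_atTop _
  set u : ℕ → ℝ := fun n => (∑ l, 1 / (τ * α l) ^ 2) / n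
        + (8 / κ * Real.exp (-((ε / 2 - δ) * Real.log n)) + 4 * Real.exp (-(δ / 2 * Real.log n)))
        + K.factorial * (8 / κ) * (∑ l, 1 / α l) * Real.exp (-((ε / 2 - 3 * δ) * Real.log n)) with hu
  have hu0 : Tendsto u atTop (𝓝 0) := by
    have h1 := tendsto_const_div_atTop_nhds_zero_nat (∑ l, 1 / (τ * α l) ^ 2)
    have h2 := (tendsto_exp_neg_mul_log (x := ε / 2 - δ) (by rw [hδ]; linarith)).const_mul (8 / κ)
    have h3 := (tendsto_exp_neg_mul_log (x := δ / 2) (by positivity)).const_mul 4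
    have h4 := (tendsto_exp_neg_mul_log (x := ε / 2 - 3 * δ) (by rw [hδ]; linarith)).const_mul
      (K.factorial * (8 / κ) * (∑ l, 1 / α l))
    have h5 := (h1.add (h2.add h3)).add h4
    simp only [mul_zero, add_zero] at h5
    exact h5
  refine tendsto_of_tendsto_of_tendsto_of_le_of_le' tendsto_const_nhds hu0 ?_ ?_
  · filter_upwards [hP, hqθ] with n hPn hqn
    refine mismatchProb_eq_zero_nonneg hα M _ (fun m hm w hw => ⟨?_, ?_⟩) A
    · exact mul_nonneg (hc.le.trans (hPn m hm w hw))
        (div_nonneg (Real.log_natCast_nonneg n) (Nat.cast_nonneg _))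
    · exact (hqn m hm w hw).le.trans (by linarith [hθ.2])
  filter_upwards [hP, hD, hqθ, hnbar, hcount, hκn, hlog, eventually_ge_atTop 2,
    eventually_ge_atTop (M.sup id)] with n hPn hDn hqn hnbarn hcountn hκn hlogn hn2 hnM
  obtain ⟨j, k, hjk, hgch⟩ := exists_gchPair_le hK hDn
  have hP0 : ∀ m ∈ M, ∀ w ∈ weakComps K m, 0 < P n m w := fun m hm w hw =>
    hc.trans_le (hPn m hm w hw)
  have hP0' : ∀ m ∈ M, ∀ w ∈ weakComps K m, 0 ≤ P n m w := fun m hm w hw => (hP0 m hm w hw).le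
  have hPbump : ∀ m ∈ M, ∀ i : Fin K, ∀ w ∈ weakComps K (m - 1), c ≤ P n m (bump i w) :=
    fun m hm i w hw => hPn m hm _ (bump_mem_weakComps (one_le_two.trans (hM m hm)) i hw)
  have hPC : ∀ m ∈ M, ∀ w ∈ weakComps K (m - 1),
      (√(P n m (bump j w)) - √(P n m (bump k w))) ^ 2 ≤ C := fun m hm w hw =>
    (sq_sqrt_sub_sqrt_le hM hP0' (hgch.trans (by linarith)) hm hw (hlow0 w)
      (hnbarn m hm w hw)).trans (hCle m hm w hw)
  have hn2' : (2 : ℝ) ≤ n := by exact_mod_cast hn2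
  have hceil : (⌈κ * n⌉₊ : ℝ) ≤ 2 * κ * n := by
    have := Nat.ceil_lt_add_one (mul_nonneg hκ.1.le (Nat.cast_nonneg (α := ℝ) n))
    linarith
  refine mismatchProb_eq_zero_le_of_gchFun_le (s := ⌈κ * n⌉₊) (C := C) (R := R) (θ := θ) (τ := τ)
    (ε := ε) (δ := δ) (κ := κ) hα hα_sum hM A hn2
    (fun m hm => (Finset.le_sup (f := id) hm).trans hnM) hjk hθ.1 hθ.2 hτ.1 hδ0 hκ.1 hC0 hR1 hP0
    (fun m hm w hw => (hqn m hm w hw).le) hPC ?_ ?_ (fun z hz m hm w hw => hcountn m hm w hw z hz)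
    (fun t ht => (gchFun_le_gchPair hM hP0' ht).trans hgch) ?_ (Nat.le_ceil _) hconst.le ?_ ?_
  · intro m hm w hw
    exact le_mul_of_sq_sqrt_sub_le hc (hc.le.trans (hPbump m hm j w hw)) (hPbump m hm k w hw)
      (hPC m hm w hw)
  · intro m hm w hw
    refine le_mul_of_sq_sqrt_sub_le hc (hc.le.trans (hPbump m hm k w hw)) (hPbump m hm j w hw) ?_
    rw [← neg_sub, neg_sq]
    exact hPC m hm w hw
  · intro z hz
    have h1 := (abs_le.mp (hz j)).1
    have h2 : τ * (α j * n) ≤ 1 / 2 * (α j * n) :=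
      mul_le_mul_of_nonneg_right hτ.2 (mul_nonneg (hα j).le (Nat.cast_nonneg n))
    have h3 : κ * n ≤ α j / 4 * n := mul_le_mul_of_nonneg_right (hκα j).le (Nat.cast_nonneg n)
    have h4 : (⌈κ * n⌉₊ : ℝ) ≤ (counts z Finset.univ j : ℝ) := by linarith
    exact_mod_cast h4
  · rw [div_le_iff₀ (by positivity)] at hlogn
    have hL0 : 0 ≤ Real.log n := Real.log_natCast_nonneg n
    have := mul_le_mul_of_nonneg_right hlogn hL0
    linarith
  · have h1 : (⌈κ * n⌉₊ : ℝ) / (n - 1) ≤ 4 * κ := by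
      rw [div_le_iff₀ (by linarith)]
      have := mul_nonneg hκ.1.le (sub_nonneg.mpr hn2')
      linarith
    refine le_trans ?_ hκshare.le
    rw [mul_div_right_comm]
    gcongr

end HSBM

theorem theorem1 {K : ℕ} (hK : 2 ≤ K) (α : Fin K → ℝ) (hα : ∀ k, 0 < α k)
    (hα_sum : ∑ k, α k = 1) (M : Finset ℕ) (hM : ∀ m ∈ M, 2 ≤ m)
    (P : ℕ → ℕ → (Fin K → ℕ) → ℝ)
    (hP : ∃ c > 0, ∀ᶠ n in atTop, ∀ m ∈ M, ∀ w ∈ HSBM.weakComps K m, c ≤ P n m w)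
    (hQ : ∀ m ∈ M, ∀ w ∈ HSBM.weakComps K m,
      Tendsto (fun n => HSBM.edgeProb P n m w) atTop (𝓝 0))
    (hD : ∃ ε > 0, ∀ᶠ n in atTop, HSBM.gch α M P n ≤ 1 - ε)
    (A : HSBM.Algorithm K) :
    ¬ HSBM.ExactRecovery α M P A ∧
      Tendsto (fun n => HSBM.mismatchProb α M (HSBM.edgeProb P n) A n fun η => 0 < η)
        atTop (𝓝 1) := by
  have h := HSBM.tendsto_mismatchProb_eq_zero hK α hα hα_sum M hM P hP hQ hD A
  refine ⟨fun hrec => zero_ne_one (tendsto_nhds_unique h hrec), ?_⟩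
  simp only [HSBM.mismatchProb_pos_eq α hα_sum]
  simpa using h.const_sub 1
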